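/- **Setting.** Let $p$ be a prime, $D\subset\mathbb N_+$ a finite non-empty set, $k$ a finite field of characteristic $p$ with $q=p^m$ elements, and $f(x)=\sum_{d\in D}\alpha_d x^d\in k[x]$. Let $a_d$ be the Teichmüller lift of $\alpha_d$ to $\mathbb Z_p[\zeta_{q-1}]\subset\mathbb C_p$, put $A=(a_d)_{d\in D}$, and fix $\pi\in\mathbb C_p$ with $\pi^{p-1}=-p$. Set $\theta(X)=\exp(\pi X-\pi X^p)$, $F_1(X)=\prod_{d\in D}\theta(a_dX^d)=\sum_{n\ge0}f_nX^n$ ($f_n=0$ for $n<0$) and $\psi_p(\sum b_nX^n)=\sum b_{pn}X^n$. Let $A_1=(f_{pi-j})_{i,j\ge1}$ be the matrix of $\alpha_1=\psi_p\circ F_1$ in the basis $X,X^2,\dots$, and write $\det(I-TA_1)=1+\sum_{n\ge1}\ell^{(1)}_nT^n$ for its Fredholm determinant (the coefficientwise limit of the polynomials $\det(I-TA_{1,S})$, where $A_{1,S}=(f_{pi-j})_{i,j\in S}$ and $S$ runs through the finite subsets of $\mathbb N_+$ ordered by inclusion). **Modular equations.** For an integer $u\ge 0$ with base $p$ digits $u_0,\dots,u_t$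 put $s_p(u)=\sum_i u_i$ and $u!!=\prod_{i=0}^{t}u_i!$. For $n\ge1$ let $E_{D,p}(n)$ be the set of tuples $U=(u_d)_{d\in D}\in\{0,\dots,p^n-1\}^D$ with $\sum_D d\,u_d\equiv0 \pmod{p^n-1}$ and $\sum_D d\,u_d>0$. For such $U$ put $\ell(U)=n$, $s_p(U)=\sum_D s_p(u_d)$ and $\varphi_n(U)=\frac1{p^n-1}\sum_D d\,u_d$. Let $\delta=\delta_{D,p}=\frac1{p-1}\min_{n\ge1}\frac1n\min_{U\in E_{D,p}(n)}s_p(U)$, and call $U\in E_{D,p}(n)$ minimal if $\frac{s_p(U)}{(p-1)n}=\delta$. Let $\delta_n$ be the map of $\{0,\dots,p^n-1\}$ to itself sending $u\le p^n-2$ to the residue of $pu$ modulo $p^n-1$ and fixing $p^n-1$, applied to tuples coordinatewise. Put $\varphi_U(i)=\varphi_n(\delta_n^i(U))$ for $0\le i\le n-1$ and $\Phi(U)=\{\varphi_U(0),\dots,\varphi_U(n-1)\}$; $U$ is irreducible if $\varphi_U$ is injective. Let $MI_{D,p}$ be the (finite) set of pairs $(n,U)$ with $U\in E_{D,p}(n)$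 minimal and irreducible, $\Sigma=\bigcup_{(n,U)\in MI_{D,p}}\Phi(U)$, $N=\#\Sigma$, and let $MI_{D,p}^*$ be the set of those $(n,U)\in MI_{D,p}$ with $\varphi_U(0)=\min\Phi(U)$ (one representative for each orbit of the shifts $\delta_n$). Let $\mathcal A_{D,p}$ be the set of subsets $\mathcal U=\{U_1,\dots,U_r\}\subset MI_{D,p}^*$ such that $\Sigma=\coprod_{t=1}^r\Phi(U_t)$, put $|\mathcal U|=\sum_t(\ell(U_t)-1)$, and $$\mathcal H^1_{D,p}(A)=\sum_{\mathcal U\in\mathcal A_{D,p}}(-1)^{|\mathcal U|}\prod_{U\in\mathcal U}\frac{A^U}{U!!},\qquad A^U=\prod_{d\in D}a_d^{\,s_p(u_d)},\quad U!!=\prod_{d\in D}u_d!!.$$ **Proposition.** The Fredholm determinant $\det(I-TA_1)$ exists, and $$\ell^{(1)}_N\equiv(-1)^N\,\mathcal H^1_{D,p}(A)\,\pi^{N(p-1)\delta}\pmod{\pi^{N(p-1)\delta+1}},$$ a congruence in the ring of integers of $\mathbb C_p$. (If $N(p-1)\delta$ is not an integer, then $\mathcal A_{D,p}=\emptyset$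 and $\mathcal H^1_{D,p}=0$, and the exponent $N(p-1)\delta$ is to be replaced by its integral part in both places: the congruence then says $\ell_N^{(1)}\equiv0\bmod\pi^{\lfloor N(p-1)\delta\rfloor+1}$.) -/

import Mathlib

/-! ### Digits -/

namespace DworkHasse

/-- The `p`-weight `s_p(u)`: the sum of the base `p` digits of `u`. -/
def weight (p u : ℕ) : ℕ := (Nat.digits p u).sum

/-- `u!!`: the product of the factorials of all the base `p` digits of `u`. -/
def digitFactorial (p u : ℕ) : ℕ := ((Nat.digits p u).map Nat.factorial).prod

/-! ### Modular equations -/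

/-- `∑_{d ∈ D} d u_d`. -/
def dot (D : Finset ℕ) (U : D → ℕ) : ℕ := ∑ d : D, (d : ℕ) * U d

/-- `E_{D,p}(n)`: the tuples in `{0, …, p ^ n - 1} ^ D` with `∑ d u_d` positive and divisible by
`p ^ n - 1` (for `n = 0` this set is empty). -/
def E (D : Finset ℕ) (p n : ℕ) : Set (D → ℕ) :=
  {U | (∀ d, U d ≤ p ^ n - 1) ∧ p ^ n - 1 ∣ dot D U ∧ 0 < dot D U}

/-- The `p`-weight of a tuple. -/
def tupleWeight (D : Finset ℕ) (p : ℕ) (U : D → ℕ) : ℕ := ∑ d : D, weight p (U d)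

/-- `s_{D,p}(n)`, the least `p`-weight of an element of `E_{D,p}(n)`. -/
noncomputable def minWeight (D : Finset ℕ) (p n : ℕ) : ℕ := sInf (tupleWeight D p '' E D p n)

/-- The `p`-density `δ_{D,p} = (p - 1)⁻¹ min_{n ≥ 1} s_{D,p}(n) / n`. -/
noncomputable def density (D : Finset ℕ) (p : ℕ) : ℝ :=
  (⨅ n : ℕ+, (minWeight D p n : ℝ) / (n : ℝ)) / ((p : ℝ) - 1)

/-- The density `s_p(U) / ((p - 1) n)` of an element of `E_{D,p}(n)`. -/
noncomputable def tupleDensity (D : Finset ℕ) (p n : ℕ) (U : D → ℕ) : ℝ :=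
  (tupleWeight D p U : ℝ) / (((p : ℝ) - 1) * (n : ℝ))

/-- The shift `δ_n` of `{0, …, p ^ n - 1}`. -/
def shift (p n k : ℕ) : ℕ := if k = p ^ n - 1 then k else (p * k) % (p ^ n - 1)

/-- The shift of a tuple, coordinate by coordinate. -/
def tupleShift (D : Finset ℕ) (p n : ℕ) (U : D → ℕ) : D → ℕ := fun d => shift p n (U d)

/-- `φ_n(U) = (∑ d u_d) / (p ^ n - 1)`; the division is exact on `E_{D,p}(n)`. -/
def phi (D : Finset ℕ) (p n : ℕ) (U : D → ℕ) : ℕ := dot D U / (p ^ n - 1)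

/-- `φ_U(k) = φ_n(δ_n ^ k (U))`. -/
def phiSeq (D : Finset ℕ) (p n : ℕ) (U : D → ℕ) (k : ℕ) : ℕ :=
  phi D p n ((tupleShift D p n)^[k] U)

/-- The support `Φ(U) = {φ_U(0), …, φ_U(n - 1)}`. -/
def support (D : Finset ℕ) (p n : ℕ) (U : D → ℕ) : Finset ℕ :=
  (Finset.range n).image (phiSeq D p n U)

/-- `MI_{D,p}(n)`: the elements of `E_{D,p}(n)` that are minimal and irreducible. -/
def MI (D : Finset ℕ) (p n : ℕ) : Set (D → ℕ) :=
  {U | U ∈ E D p n ∧ tupleDensity D p n U = density D p ∧ (support D p n U).card = n}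

/-- The disjoint union `MI_{D,p}` of the `MI_{D,p}(n)`, as a set of pairs `(n, U)`. -/
def MIAll (D : Finset ℕ) (p : ℕ) : Set (ℕ × (D → ℕ)) := {x | x.2 ∈ MI D p x.1}

/-- `Σ_{D,p}`, the union of the supports of the minimal irreducible elements. -/
def sigmaSet (D : Finset ℕ) (p : ℕ) : Set ℕ :=
  ⋃ x ∈ MIAll D p, (support D p x.1 x.2 : Set ℕ)

/-- `N_{D,p}`, the cardinality of `Σ_{D,p}` (which is a finite set, see `sigmaSet_finite`). -/
noncomputable def sigmaCard (D : Finset ℕ) (p : ℕ) : ℕ := (sigmaSet D p).ncard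

/-- `MI*_{D,p}`, the set of orbits of the shift on `MI_{D,p}`; each orbit is represented by its
unique element `U` with `φ_U(0) = min Φ(U)`. -/
def MIStar (D : Finset ℕ) (p : ℕ) : Set (ℕ × (D → ℕ)) :=
  {x ∈ MIAll D p | ∀ v ∈ support D p x.1 x.2, phiSeq D p x.1 x.2 0 ≤ v}

/-- `𝒜_{D,p}`: the finite sets `{U_1, …, U_k} ⊆ MI*_{D,p}` whose supports are pairwise disjoint
and have union `Σ_{D,p}`. -/
def partitions (D : Finset ℕ) (p : ℕ) : Set (Finset (ℕ × (D → ℕ))) :=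
  {𝒰 | (𝒰 : Set (ℕ × (D → ℕ))) ⊆ MIStar D p ∧
    (𝒰 : Set (ℕ × (D → ℕ))).PairwiseDisjoint (fun x => support D p x.1 x.2) ∧
    (⋃ x ∈ 𝒰, (support D p x.1 x.2 : Set ℕ)) = sigmaSet D p}

/-- The term `A^U / U!!`. Here `A^U` is the product, over `d ∈ D` and over the base `p` digits `u`
of `u_d`, of `a_d ^ u`, that is `∏_d a_d ^ s_p(u_d)`, and `U!! = ∏_d u_d!!`. -/
noncomputable def hasseTerm (D : Finset ℕ) (p : ℕ) (U : D → ℕ) : MvPolynomial D ℚ :=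
  MvPolynomial.C (∏ d : D, (digitFactorial p (U d) : ℚ))⁻¹ *
    ∏ d : D, MvPolynomial.X d ^ weight p (U d)

/-- The Hasse polynomial `∑_{𝒰 ∈ 𝒜_{D,p}} (-1) ^ |𝒰| ∏_{U ∈ 𝒰} A^U / U!!`, with
`|𝒰| = ∑_{U ∈ 𝒰} (ℓ(U) - 1)`. The sum is finite, see `partitions_finite`; the coefficients are
rational numbers whose denominators are prime to `p`. -/
noncomputable def hassePoly (D : Finset ℕ) (p : ℕ) : MvPolynomial D ℚ :=
  ∑ᶠ 𝒰 ∈ partitions D p,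
    (-1) ^ (∑ x ∈ 𝒰, (x.1 - 1)) * ∏ x ∈ 𝒰, hasseTerm D p x.2

/-! ### Finiteness of the sets above -/

theorem phi_le (D : Finset ℕ) {p n : ℕ} {U : D → ℕ} (hU : ∀ d, U d ≤ p ^ n - 1) :
    phi D p n U ≤ ∑ d : D, (d : ℕ) := by
  unfold phi
  rcases Nat.eq_zero_or_pos (p ^ n - 1) with h | h
  · simp [h]
  · apply Nat.div_le_of_le_mul
    unfold dot
    rw [Finset.mul_sum]
    refine Finset.sum_le_sum fun d _ => ?_
    rw [mul_comm]
    exact Nat.mul_le_mul_right _ (hU d)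

theorem tupleShift_iterate_le (D : Finset ℕ) {p n : ℕ} {U : D → ℕ} (hU : ∀ d, U d ≤ p ^ n - 1)
    (k : ℕ) : ∀ d, (tupleShift D p n)^[k] U d ≤ p ^ n - 1 := by
  induction k with
  | zero => simpa using hU
  | succ k ih =>
    intro d
    rw [Function.iterate_succ_apply']
    have := ih d
    simp only [tupleShift, shift]
    split_ifs with h
    · exact this
    · exact (Nat.mod_lt _ (by omega)).le

theorem support_le (D : Finset ℕ) {p n : ℕ} {U : D → ℕ} (hU : U ∈ E D p n) {v : ℕ}
    (hv : v ∈ support D p n U) : v ≤ ∑ d : D, (d : ℕ) := by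
  obtain ⟨k, -, rfl⟩ := Finset.mem_image.1 hv
  exact phi_le D (tupleShift_iterate_le D hU.1 k)

theorem sigmaSet_finite (D : Finset ℕ) (p : ℕ) : (sigmaSet D p).Finite := by
  refine (Set.finite_Iic (∑ d : D, (d : ℕ))).subset fun v hv => ?_
  simp only [sigmaSet, Set.mem_iUnion] at hv
  obtain ⟨x, hx, hv⟩ := hv
  exact support_le D hx.1 hv

theorem MIAll_finite (D : Finset ℕ) (p : ℕ) : (MIAll D p).Finite := by
  have key : ∀ n, (MI D p n).Finite := fun n =>
    (Set.Finite.pi' (fun _ : D => Set.finite_Iic (p ^ n - 1))).subset fun U hU d => hU.1.1 d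
  refine (((Set.finite_Iic ((∑ d : D, (d : ℕ)) + 1)).biUnion
    fun n _ => (key n).image (Prod.mk n))).subset ?_
  rintro ⟨n, U⟩ hx
  refine Set.mem_biUnion (x := n) ?_ ⟨U, hx, rfl⟩
  have hs : support D p n U ⊆ Finset.range ((∑ d : D, (d : ℕ)) + 1) := fun v hv =>
    Finset.mem_range.2 (Nat.lt_succ_of_le (support_le D hx.1 hv))
  have := Finset.card_le_card hs
  rw [hx.2.2, Finset.card_range] at this
  exact this

theorem partitions_finite (D : Finset ℕ) (p : ℕ) : (partitions D p).Finite :=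
  ((MIAll_finite D p).finite_subsets.preimage Finset.coe_injective.injOn).subset
    fun _ h => h.1.trans fun _ hx => hx.1

/-! ### Dwork's operator -/

open PowerSeries in
/-- Dwork's splitting function `θ(X) = exp(π X - π X ^ p)`. -/
noncomputable def theta {K : Type*} [Field K] [CharZero K] (p : ℕ) (ϖ : K) : PowerSeries K :=
  (PowerSeries.exp K).subst (C ϖ * X - C ϖ * X ^ p)

open PowerSeries in
/-- `F_1(X) = ∏_{d ∈ D} θ(a_d X ^ d)`. -/
noncomputable def F₁ {K : Type*} [Field K] [CharZero K] (p : ℕ) (ϖ : K) (D : Finset ℕ)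
    (a : D → K) : PowerSeries K :=
  ∏ d : D, (theta p ϖ).subst (C (a d) * X ^ (d : ℕ))

/-- `ψ_p (∑ b_n X ^ n) = ∑ b_{pn} X ^ n`. -/
noncomputable def psi {K : Type*} [Field K] (p : ℕ) (h : PowerSeries K) : PowerSeries K :=
  PowerSeries.mk fun n => PowerSeries.coeff (p * n) h

/-- Dwork's operator `α_1 = ψ_p ∘ F_1`. -/
noncomputable def alpha₁ {K : Type*} [Field K] [CharZero K] (p : ℕ) (ϖ : K) (D : Finset ℕ)
    (a : D → K) (h : PowerSeries K) : PowerSeries K :=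
  psi p (F₁ p ϖ D a * h)

/-- The matrix `A_1` of `α_1` in the basis `X, X ^ 2, …`: the column with index `j` holds the
coefficients of `α_1 (X ^ j)`. -/
noncomputable def A₁ {K : Type*} [Field K] [CharZero K] (p : ℕ) (ϖ : K) (D : Finset ℕ)
    (a : D → K) : Matrix ℕ+ ℕ+ K :=
  fun i j => PowerSeries.coeff (i : ℕ) (alpha₁ p ϖ D a (PowerSeries.X ^ (j : ℕ)))

/-- The entries of `A_1` are `f_{pi - j}`, where `F_1 = ∑ f_n X ^ n` and `f_n = 0` for `n < 0`. -/
theorem A₁_apply {K : Type*} [Field K] [CharZero K] (p : ℕ) (ϖ : K) (D : Finset ℕ)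
    (a : D → K) (i j : ℕ+) :
    A₁ p ϖ D a i j =
      if (j : ℕ) ≤ p * i then PowerSeries.coeff (p * i - j) (F₁ p ϖ D a) else 0 := by
  simp [A₁, alpha₁, psi, PowerSeries.coeff_mul_X_pow']

/-! ### Fredholm determinants -/

/-- `P = det(I - T A)` for an infinite matrix `A`: the polynomials `det(I - T A_S)` attached to the
finite principal submatrices `A_S` of `A` converge to the power series `P`, coefficient by
coefficient, as the finite set `S` grows. (`Matrix.charpolyRev M` is `det(1 - X M)`.) -/
def IsFredholmDet {ι K : Type*} [DecidableEq ι] [NormedField K] (A : Matrix ι ι K)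
    (P : PowerSeries K) : Prop :=
  ∀ n : ℕ, Filter.Tendsto
    (fun S : Finset ι => (A.submatrix (Subtype.val : S → ι) Subtype.val).charpolyRev.coeff n)
    Filter.atTop (nhds (PowerSeries.coeff n P))

/-- There is at most one such power series. -/
theorem IsFredholmDet.unique {ι K : Type*} [DecidableEq ι] [NormedField K] {A : Matrix ι ι K}
    {P Q : PowerSeries K} (hP : IsFredholmDet A P) (hQ : IsFredholmDet A Q) : P = Q :=
  PowerSeries.ext fun n => tendsto_nhds_unique (hP n) (hQ n)

/-- `x ≡ y mod ϖ ^ r` in the ring of integers: `x - y` is `ϖ ^ r` times an element of norm at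
most one. -/
def CongrMod {K : Type*} [NormedField K] (ϖ : K) (r : ℕ) (x y : K) : Prop :=
  ∃ c : K, ‖c‖ ≤ 1 ∧ x - y = ϖ ^ r * c

/-- The coefficients `(a_d)_{d ∈ D}` of `f̃`: the Teichmüller lifts of the coefficients of `f`,
seen in `K` through an embedding `j` of the ring `W(k)` of Witt vectors of `k`. -/
noncomputable def liftCoeff {k K : Type*} [Field k] [Field K] (p : ℕ) [Fact p.Prime]
    (j : WittVector p k →+* K) (D : Finset ℕ) (f : Polynomial k) : D → K :=
  fun d => j (WittVector.teichmuller p (f.coeff d))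

end DworkHasse

/-!
Write `θ = ∑ θ_u X ^ u`. Then `|θ_u| ≤ |π| ^ s_p(u)`, strictly so for `u ≥ p`, while
`θ_u = π ^ u / u!` for `u < p`: with `u = p n + t`, `t < p`, the coefficient `θ_u` is, up to a
normalisation by powers of `π` and factorials, the `n`-th finite difference at `0` of
`a ↦ (-p) ^ a a! / (p a + t)!`, whose values are units that depend on `a` continuously modulo
powers of `p`.

Expanding the entries `f_{pi - j}` of `A_1` in monomials, a principal minor on a set `S` is a sum
over permutations `σ` of `S` and exponents `u_{i,d}` with `∑_d d u_{i,d} = p i - σ(i)`. If the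
`u_{i,d}` are digits, then these relations along a cycle of `σ` of length `n` say that the numbers
with base `p` digits `u_{i,d}`, read along the cycle, form an element of `E(n)` whose support is
the cycle. Hence the weight of every term is at least `#S (p - 1) δ`, and a term whose order is not
larger than this has digits as exponents and minimal irreducible elements on its cycles, so that
`S ⊆ Σ`. For `#S = N` only the minor on `Σ` contributes modulo `π ^ (⌊N (p - 1) δ⌋ + 1)`, and its
critical terms correspond to the partitions of `Σ` into supports of minimal irreducible elements.
-/

namespace DworkHasse

/-! ### Digit sums -/

section DigitSums

variable {p : ℕ}

theorem weight_zero (p : ℕ) : weight p 0 = 0 := by simp [weight]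

theorem weight_mul_add (hp : 1 < p) (v : ℕ) {t : ℕ} (ht : t < p) :
    weight p (p * v + t) = weight p v + t := by
  by_cases h : t = 0 ∧ v = 0
  · obtain ⟨rfl, rfl⟩ := h
    simp [weight_zero]
  · rw [weight, weight, add_comm, Nat.digits_add p hp t v ht (by tauto), List.sum_cons, add_comm]

theorem digitFactorial_mul_add (hp : 1 < p) (v : ℕ) {t : ℕ} (ht : t < p) :
    digitFactorial p (p * v + t) = digitFactorial p v * t.factorial := by
  by_cases h : t = 0 ∧ v = 0
  · obtain ⟨rfl, rfl⟩ := h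
    simp
  · rw [digitFactorial, digitFactorial, add_comm, Nat.digits_add p hp t v ht (by tauto),
      List.map_cons, List.prod_cons, mul_comm]

theorem weight_of_lt {t : ℕ} (hp : 1 < p) (ht : t < p) : weight p t = t := by
  simpa [weight_zero] using weight_mul_add hp 0 ht

theorem weight_mul (hp : 1 < p) (v : ℕ) : weight p (p * v) = weight p v := by
  simpa using weight_mul_add hp v (zero_lt_one.trans hp)

theorem weight_div_add_mod (hp : 1 < p) (v : ℕ) : weight p (v / p) + v % p = weight p v := by
  rw [← weight_mul_add hp _ (Nat.mod_lt v (by omega)), Nat.div_add_mod]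

theorem weight_succ_le (hp : 1 < p) (v : ℕ) : weight p (v + 1) ≤ weight p v + 1 := by
  induction v using Nat.strong_induction_on with
  | _ v ih =>
    rw [← weight_div_add_mod hp v]
    have hv := Nat.div_add_mod v p
    obtain hlt | hge := lt_or_ge (v % p + 1) p
    · rw [← hv, add_assoc, weight_mul_add hp _ hlt, hv, add_assoc]
    · have hcarry : v + 1 = p * (v / p + 1) := by
        have := Nat.mod_lt v (by omega : p > 0)
        rw [mul_add]
        omega
      have hv0 : v ≠ 0 := by
        rintro rfl
        simp at hge
        omega
      rw [hcarry, weight_mul hp]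
      exact (ih _ (Nat.div_lt_self (Nat.pos_of_ne_zero hv0) hp)).trans (by omega)

theorem weight_add_le_add_self (hp : 1 < p) (v t : ℕ) : weight p (v + t) ≤ weight p v + t := by
  induction t with
  | zero => rfl
  | succ t ih => exact (weight_succ_le hp _).trans (Nat.add_le_add_right ih 1)

theorem weight_add_le (hp : 1 < p) (a b : ℕ) : weight p (a + b) ≤ weight p a + weight p b := by
  induction a using Nat.strong_induction_on generalizing b with
  | _ a ih =>
    obtain rfl | ha := Nat.eq_zero_or_pos a
    · simp
    have hab : a + b = p * (a / p + b / p) + b % p + a % p := by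
      conv_lhs => rw [← Nat.div_add_mod a p, ← Nat.div_add_mod b p]
      ring
    calc weight p (a + b) ≤ weight p (p * (a / p + b / p) + b % p) + a % p :=
          hab ▸ weight_add_le_add_self hp _ _
      _ = weight p (a / p + b / p) + b % p + a % p := by
          rw [weight_mul_add hp _ (Nat.mod_lt b (by omega))]
      _ ≤ weight p (a / p) + weight p (b / p) + b % p + a % p := by
          gcongr
          exact ih _ (Nat.div_lt_self ha hp) _
      _ = weight p a + weight p b := by
          rw [← weight_div_add_mod hp a, ← weight_div_add_mod hp b]
          ring

theorem weight_add_pow_mul (hp : 1 < p) (n : ℕ) {a : ℕ} (ha : a < p ^ n) (b : ℕ) :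
    weight p (a + p ^ n * b) = weight p a + weight p b := by
  induction n generalizing a with
  | zero => simp_all [weight_zero]
  | succ n ih =>
    have hdiv : a / p < p ^ n := Nat.div_lt_of_lt_mul (by rwa [pow_succ'] at ha)
    have hsplit : a + p ^ (n + 1) * b = p * (a / p + p ^ n * b) + a % p := by
      conv_lhs => rw [← Nat.div_add_mod a p]
      ring
    rw [hsplit, weight_mul_add hp _ (Nat.mod_lt a (by omega)), ih hdiv, ← weight_div_add_mod hp a]
    ring

theorem weight_mod_add_div (hp : 1 < p) (n v : ℕ) :
    weight p (v % p ^ n) + weight p (v / p ^ n) = weight p v := by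
  rw [← weight_add_pow_mul hp n (Nat.mod_lt v (by positivity)), Nat.mod_add_div]

theorem mod_add_div_modEq_sub_one {m : ℕ} (hm : 0 < m) (v : ℕ) :
    v % m + v / m ≡ v [MOD m - 1] := by
  obtain ⟨q, rfl⟩ : ∃ q, m = q + 1 := ⟨m - 1, by omega⟩
  have hv : v = v % (q + 1) + v / (q + 1) + q * (v / (q + 1)) := by
    conv_lhs => rw [← Nat.mod_add_div v (q + 1)]
    ring
  conv_rhs => rw [hv]
  simp [Nat.ModEq]

/-- The successive sums `v % p ^ n + v / p ^ n` decrease to a number with at most `n` digits. -/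
theorem exists_le_modEq_weight_le {n : ℕ} (hp : 1 < p) (hn : 0 < n) (v : ℕ) :
    ∃ v' ≤ p ^ n - 1, v' ≡ v [MOD p ^ n - 1] ∧ weight p v' ≤ weight p v ∧ (0 < v → 0 < v') := by
  have hq : 1 < p ^ n := Nat.one_lt_pow hn.ne' hp
  induction v using Nat.strong_induction_on with
  | _ v ih =>
    obtain hv | hv := lt_or_ge v (p ^ n)
    · exact ⟨v, by omega, rfl, le_rfl, id⟩
    have hdiv : 0 < v / p ^ n := Nat.div_pos hv (by omega)
    have hlt : v % p ^ n + v / p ^ n < v := by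
      have := Nat.mod_add_div v (p ^ n)
      have : 2 * (v / p ^ n) ≤ p ^ n * (v / p ^ n) := Nat.mul_le_mul_right _ hq
      omega
    obtain ⟨v', hle, hmod, hweight, hpos⟩ := ih _ hlt
    refine ⟨v', hle, hmod.trans (mod_add_div_modEq_sub_one (by omega) v), hweight.trans ?_,
      fun _ => hpos (Nat.add_pos_right _ hdiv)⟩
    exact (weight_add_le hp _ _).trans_eq (weight_mod_add_div hp n v)

end DigitSums

/-! ### Numbers given by a sequence of digits -/

section Horner

variable {p : ℕ}

/-- The number `∑_{k < n} w_k p ^ (n - 1 - k)` whose `n` base `p` digits are `w_0, …, w_{n - 1}`,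
the most significant one first. With this order the shift `δ_n` is the shift of the sequence. -/
def horner (p : ℕ) (w : ℕ → ℕ) : ℕ → ℕ
  | 0 => 0
  | n + 1 => p * horner p w n + w n

theorem horner_congr {n : ℕ} {w w' : ℕ → ℕ} (h : ∀ k < n, w k = w' k) :
    horner p w n = horner p w' n := by
  induction n with
  | zero => rfl
  | succ n ih => rw [horner, horner, ih fun k hk => h k (by omega), h n (by omega)]

theorem horner_succ' (p : ℕ) (w : ℕ → ℕ) (n : ℕ) :
    horner p w (n + 1) = p ^ n * w 0 + horner p (fun k => w (k + 1)) n := by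
  induction n with
  | zero => simp [horner]
  | succ n ih =>
    rw [horner, ih, horner]
    ring

theorem horner_lt {w : ℕ → ℕ} (hw : ∀ k, w k < p) (n : ℕ) : horner p w n < p ^ n := by
  induction n with
  | zero => simp [horner]
  | succ n ih =>
    calc horner p w (n + 1) < p * horner p w n + p := Nat.add_lt_add_left (hw n) _
      _ = p * (horner p w n + 1) := by ring
      _ ≤ p ^ (n + 1) := by rw [pow_succ']; exact Nat.mul_le_mul_left _ ih

theorem weight_horner_le (hp : 1 < p) (w : ℕ → ℕ) (n : ℕ) :
    weight p (horner p w n) ≤ ∑ k ∈ Finset.range n, weight p (w k) := by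
  induction n with
  | zero => simp [horner, weight_zero]
  | succ n ih =>
    rw [Finset.sum_range_succ, horner]
    refine (weight_add_le hp _ _).trans ?_
    rw [weight_mul hp]
    omega

theorem weight_horner (hp : 1 < p) {w : ℕ → ℕ} (hw : ∀ k, w k < p) (n : ℕ) :
    weight p (horner p w n) = ∑ k ∈ Finset.range n, w k := by
  induction n with
  | zero => simp [horner, weight_zero]
  | succ n ih => rw [Finset.sum_range_succ, horner, weight_mul_add hp _ (hw n), ih]

theorem digitFactorial_horner (hp : 1 < p) {w : ℕ → ℕ} (hw : ∀ k, w k < p) (n : ℕ) :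
    digitFactorial p (horner p w n) = ∏ k ∈ Finset.range n, (w k).factorial := by
  induction n with
  | zero => simp [horner, digitFactorial]
  | succ n ih => rw [Finset.prod_range_succ, horner, digitFactorial_mul_add hp _ (hw n), ih]

theorem horner_digits {n v : ℕ} (hv : v < p ^ n) :
    horner p (fun k => v / p ^ (n - 1 - k) % p) n = v := by
  have hprefix : ∀ m ≤ n, horner p (fun k => v / p ^ (n - 1 - k) % p) m = v / p ^ (n - m) := by
    intro m
    induction m with
    | zero => intro _; simp [horner, Nat.div_eq_of_lt hv]
    | succ m ih =>
      intro hm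
      rw [horner, ih (by omega), show n - m = n - 1 - m + 1 by omega,
        show n - (m + 1) = n - 1 - m by omega, pow_succ, ← Nat.div_div_eq_div_mul]
      exact Nat.div_add_mod _ _
  simpa using hprefix n le_rfl

theorem eq_of_horner_eq {w w' : ℕ → ℕ} (hw : ∀ k, w k < p) (hw' : ∀ k, w' k < p) {n : ℕ}
    (h : horner p w n = horner p w' n) : ∀ k < n, w k = w' k := by
  induction n with
  | zero => simp
  | succ n ih =>
    rw [horner, horner] at h
    have hlast : w n = w' n := by
      simpa [Nat.mul_add_mod, Nat.mod_eq_of_lt, hw, hw'] using congrArg (· % p) h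
    have hinit : horner p w n = horner p w' n :=
      Nat.eq_of_mul_eq_mul_left ((Nat.zero_le _).trans_lt (hw 0)) (by omega)
    intro k hk
    obtain hk | rfl := Nat.lt_succ_iff_lt_or_eq.1 hk
    · exact ih hinit k hk
    · exact hlast

theorem mul_horner_of_periodic {w : ℕ → ℕ} {n : ℕ} (hp : 0 < p) (hwn : w n = w 0) :
    p * horner p w n = (p ^ n - 1) * w 0 + horner p (fun k => w (k + 1)) n := by
  have h := horner_succ' p w n
  rw [horner, hwn] at h
  have : w 0 ≤ p ^ n * w 0 := Nat.le_mul_of_pos_left _ (by positivity)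
  rw [Nat.sub_mul, one_mul]
  omega

theorem shift_eq_of_mul_eq {n v v' t : ℕ} (hn : n ≠ 0) (hv' : v' ≤ p ^ n - 1) (ht : t < p)
    (h : p * v = (p ^ n - 1) * t + v') : shift p n v = v' := by
  have hp : 0 < p := by omega
  rw [shift]
  split_ifs with hvq
  · have hfull : v' = (p ^ n - 1) * (p - t) := by
      rw [hvq, mul_comm p] at h
      rw [Nat.mul_sub]
      omega
    have : p ^ n - 1 ≤ v' := hfull ▸ Nat.le_mul_of_pos_right _ (by omega)
    omega
  · rw [h, Nat.mul_add_mod]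
    refine Nat.mod_eq_of_lt (lt_of_le_of_ne hv' fun hv'q => hvq ?_)
    rw [hv'q, ← Nat.mul_succ] at h
    have hcop : Nat.Coprime p (p ^ n - 1) :=
      (Nat.coprime_self_sub_right (Nat.one_le_pow n p hp)).2 (Nat.coprime_one_right _)
        |>.coprime_dvd_left (dvd_pow_self p hn)
    have htp : p ≤ t + 1 :=
      Nat.le_of_dvd t.succ_pos (hcop.dvd_of_dvd_mul_left (h ▸ dvd_mul_right p v))
    rw [show t.succ = p by omega, mul_comm] at h
    exact Nat.eq_of_mul_eq_mul_right hp h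

theorem shift_horner {w : ℕ → ℕ} (hw : ∀ k, w k < p) {n : ℕ} (hn : n ≠ 0) (hwn : w n = w 0) :
    shift p n (horner p w n) = horner p (fun k => w (k + 1)) n := by
  have hlt := horner_lt (fun k => hw (k + 1)) n
  exact shift_eq_of_mul_eq hn (by omega) (hw 0)
    (mul_horner_of_periodic ((Nat.zero_le _).trans_lt (hw 0)) hwn)

end Horner

/-! ### Tuples given by a sequence of tuples of digits -/

section Tuple

variable {D : Finset ℕ} {p : ℕ}

/-- The tuple `∑_{k < n} w_k p ^ (n - 1 - k)` with tuples of digits `w_0, …, w_{n - 1}`. -/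
def tupleHorner (D : Finset ℕ) (p : ℕ) (w : ℕ → D → ℕ) (n : ℕ) : D → ℕ :=
  fun d => horner p (fun k => w k d) n

/-- The relation `∑ d w_{k,d} = p c_k - c_{k+1}` between a sequence of exponents `w` and a sequence
of indices `c`: the exponents `w_k` occur in the coefficient of index `p c_k - c_{k+1}` of `F_1`. It
also holds between the digits `w` of an element `U` of `E_{D,p}(n)` and the numbers `φ_U(k)`. -/
def IsCarrySeq (D : Finset ℕ) (p : ℕ) (w : ℕ → D → ℕ) (c : ℕ → ℕ) : Prop :=
  ∀ k, dot D (w k) + c (k + 1) = p * c k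

theorem dot_tupleHorner_succ (w : ℕ → D → ℕ) (n : ℕ) :
    dot D (tupleHorner D p w (n + 1)) = p * dot D (tupleHorner D p w n) + dot D (w n) := by
  simp only [dot, tupleHorner, horner, Finset.mul_sum, ← Finset.sum_add_distrib]
  exact Finset.sum_congr rfl fun d _ => by ring

theorem mul_dot_tupleHorner_of_periodic {w : ℕ → D → ℕ} {n : ℕ} (hp : 0 < p) (hwn : w n = w 0) :
    p * dot D (tupleHorner D p w n) =
      (p ^ n - 1) * dot D (w 0) + dot D (tupleHorner D p (fun k => w (k + 1)) n) := by
  simp only [dot, tupleHorner, Finset.mul_sum, ← Finset.sum_add_distrib]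
  refine Finset.sum_congr rfl fun d _ => ?_
  rw [mul_left_comm, mul_horner_of_periodic hp (congrFun hwn d)]
  ring

theorem tupleWeight_tupleHorner (hp : 1 < p) {w : ℕ → D → ℕ} (hw : ∀ k d, w k d < p) (n : ℕ) :
    tupleWeight D p (tupleHorner D p w n) = ∑ k ∈ Finset.range n, tupleWeight D p (w k) := by
  simp only [tupleWeight]
  rw [Finset.sum_comm]
  refine Finset.sum_congr rfl fun d _ => ?_
  rw [tupleHorner, weight_horner hp (fun k => hw k d)]
  exact Finset.sum_congr rfl fun k _ => (weight_of_lt hp (hw k d)).symm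

theorem iterate_tupleShift_tupleHorner {w : ℕ → D → ℕ} (hw : ∀ k d, w k d < p) {n : ℕ}
    (hn : n ≠ 0) (hper : w.Periodic n) (m : ℕ) :
    (tupleShift D p n)^[m] (tupleHorner D p w n) = tupleHorner D p (fun k => w (k + m)) n := by
  induction m with
  | zero => rfl
  | succ m ih =>
    rw [Function.iterate_succ_apply', ih]
    funext d
    have hshift := shift_horner (w := fun k => w (k + m) d) (fun k => hw _ d) hn
      (by rw [add_comm n m, hper, zero_add])
    rw [tupleShift, tupleHorner, hshift, tupleHorner]
    exact horner_congr fun k _ => by rw [add_right_comm, add_assoc]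

namespace IsCarrySeq

variable {w : ℕ → D → ℕ} {c : ℕ → ℕ}

theorem dot_tupleHorner_add (hc : IsCarrySeq D p w c) (n : ℕ) :
    dot D (tupleHorner D p w n) + c n = p ^ n * c 0 := by
  induction n with
  | zero => simp [tupleHorner, horner, dot]
  | succ n ih =>
    rw [dot_tupleHorner_succ, pow_succ', mul_assoc, ← ih, mul_add, ← hc n]
    ring

theorem dot_tupleHorner (hc : IsCarrySeq D p w c) {n : ℕ} (hn : c n = c 0) :
    dot D (tupleHorner D p w n) = (p ^ n - 1) * c 0 := by
  have := hc.dot_tupleHorner_add n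
  rw [Nat.sub_mul]
  omega

theorem comp_add_right (hc : IsCarrySeq D p w c) (m : ℕ) :
    IsCarrySeq D p (fun k => w (k + m)) (fun k => c (k + m)) := fun k => by
  have h := hc (k + m)
  rwa [add_right_comm] at h

theorem pos_of_pos_add (hc : IsCarrySeq D p w c) {k m : ℕ} (h : 0 < c (k + m)) : 0 < c k := by
  induction m with
  | zero => exact h
  | succ m ih =>
    have := hc (k + m)
    rw [add_assoc] at this
    exact ih (Nat.pos_of_mul_pos_left (a := p) (by omega))

theorem phiSeq_tupleHorner (hc : IsCarrySeq D p w c) (hp : 1 < p) (hw : ∀ k d, w k d < p) {n : ℕ}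
    (hn : n ≠ 0) (hwper : w.Periodic n) (hcper : c.Periodic n) (m : ℕ) :
    phiSeq D p n (tupleHorner D p w n) m = c m := by
  have hq : 1 < p ^ n := Nat.one_lt_pow hn hp
  have hclosed : c (n + m) = c (0 + m) := by rw [add_comm n m, hcper, zero_add]
  rw [phiSeq, iterate_tupleShift_tupleHorner hw hn hwper, phi,
    (hc.comp_add_right m).dot_tupleHorner hclosed, zero_add,
    Nat.mul_div_cancel_left _ (by omega)]

end IsCarrySeq

/-! ### The density as a lower bound for weights -/

theorem density_nonneg (D : Finset ℕ) (hp : 1 < p) : 0 ≤ density D p :=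
  div_nonneg (Real.iInf_nonneg fun n => by positivity) (sub_nonneg.2 (by exact_mod_cast hp.le))

theorem pos_of_mem_E {n : ℕ} {U : D → ℕ} (hU : U ∈ E D p n) : 0 < n := by
  refine Nat.pos_of_ne_zero fun hn => hU.2.2.ne' ?_
  subst hn
  have hzero : ∀ d, U d = 0 := by simpa using hU.1
  simp [dot, hzero]

theorem mul_density_le (hp : 1 < p) {n : ℕ} {U : D → ℕ} (hU : U ∈ E D p n) :
    (n : ℝ) * (((p : ℝ) - 1) * density D p) ≤ tupleWeight D p U := by
  have hn := pos_of_mem_E hU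
  have hp1 : (p : ℝ) - 1 ≠ 0 := (sub_pos.2 (by exact_mod_cast hp)).ne'
  have hinf : (⨅ n : ℕ+, (minWeight D p n : ℝ) / (n : ℝ)) ≤ (minWeight D p n : ℝ) / n :=
    ciInf_le (f := fun n : ℕ+ => (minWeight D p n : ℝ) / ((n : ℕ) : ℝ))
      ⟨0, by rintro _ ⟨m, rfl⟩; positivity⟩ ⟨n, hn⟩
  rw [le_div_iff₀ (by exact_mod_cast hn)] at hinf
  have hmin : minWeight D p n ≤ tupleWeight D p U := Nat.sInf_le ⟨U, hU, rfl⟩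
  calc (n : ℝ) * (((p : ℝ) - 1) * density D p) ≤ (minWeight D p n : ℝ) := by
        rw [density, mul_div_cancel₀ _ hp1, mul_comm]
        exact hinf
    _ ≤ tupleWeight D p U := by exact_mod_cast hmin

theorem tupleDensity_eq_density_iff (hp : 1 < p) {n : ℕ} (hn : n ≠ 0) {U : D → ℕ} :
    tupleDensity D p n U = density D p ↔
      (tupleWeight D p U : ℝ) = n * (((p : ℝ) - 1) * density D p) := by
  have hp1 : (p : ℝ) - 1 ≠ 0 := (sub_pos.2 (by exact_mod_cast hp)).ne'
  have hn0 : (n : ℝ) ≠ 0 := by exact_mod_cast hn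
  rw [tupleDensity, div_eq_iff (mul_ne_zero hp1 hn0)]
  ring_nf

theorem exists_mem_E_tupleWeight_le (hp : 1 < p) {n : ℕ} (hn : 0 < n) {V : D → ℕ}
    (hdvd : p ^ n - 1 ∣ dot D V) (hpos : 0 < dot D V) :
    ∃ U ∈ E D p n, tupleWeight D p U ≤ tupleWeight D p V := by
  choose U hle hmod hweight hUpos using fun d : D => exists_le_modEq_weight_le hp hn (V d)
  have hdot : dot D U ≡ dot D V [MOD p ^ n - 1] :=
    Nat.ModEq.sum fun d _ => (hmod d).mul_left _
  refine ⟨U, ⟨hle, (hdot.dvd_iff dvd_rfl).2 hdvd, ?_⟩, Finset.sum_le_sum fun d _ => hweight d⟩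
  rw [dot, Finset.sum_pos_iff] at hpos ⊢
  obtain ⟨d, hd, hpos⟩ := hpos
  exact ⟨d, hd, Nat.mul_pos (Nat.pos_of_mul_pos_right hpos)
    (hUpos d (Nat.pos_of_mul_pos_left hpos))⟩

theorem IsCarrySeq.mul_density_le_sum {w : ℕ → D → ℕ} {c : ℕ → ℕ} (hc : IsCarrySeq D p w c)
    (hp : 1 < p) {n : ℕ} (hn : 0 < n) (hcn : c n = c 0) (hc0 : 0 < c 0) :
    (n : ℝ) * (((p : ℝ) - 1) * density D p) ≤
      (∑ k ∈ Finset.range n, tupleWeight D p (w k) : ℕ) := by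
  have hq : 1 < p ^ n := Nat.one_lt_pow hn.ne' hp
  have hdot := hc.dot_tupleHorner hcn
  obtain ⟨U, hU, hweight⟩ := exists_mem_E_tupleWeight_le hp hn (hdot ▸ dvd_mul_right _ _)
    (hdot ▸ Nat.mul_pos (by omega) hc0)
  refine (mul_density_le hp hU).trans ?_
  norm_cast
  calc tupleWeight D p U ≤ ∑ d : D, ∑ k ∈ Finset.range n, weight p (w k d) :=
        hweight.trans (Finset.sum_le_sum fun d _ => weight_horner_le hp _ n)
    _ = ∑ k ∈ Finset.range n, tupleWeight D p (w k) := Finset.sum_comm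

/-! ### The digits of a tuple -/

/-- The tuple of the digits of index `k` of the numbers `U_d < p ^ n`, the digits being counted
modulo `n` from the most significant one. -/
def tupleDigits (D : Finset ℕ) (p n : ℕ) (U : D → ℕ) (k : ℕ) : D → ℕ :=
  fun d => U d / p ^ (n - 1 - k % n) % p

theorem tupleDigits_lt {n : ℕ} (hp : 0 < p) (U : D → ℕ) (k : ℕ) (d : D) :
    tupleDigits D p n U k d < p :=
  Nat.mod_lt _ hp

theorem periodic_tupleDigits (n : ℕ) (U : D → ℕ) : (tupleDigits D p n U).Periodic n := fun k => by
  funext d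
  simp [tupleDigits]

theorem tupleHorner_tupleDigits {n : ℕ} {U : D → ℕ} (hp : 0 < p) (hU : ∀ d, U d ≤ p ^ n - 1) :
    tupleHorner D p (tupleDigits D p n U) n = U := by
  funext d
  have hlt : U d < p ^ n := (hU d).trans_lt (Nat.sub_lt (by positivity) one_pos)
  rw [tupleHorner]
  conv_rhs => rw [← horner_digits hlt]
  exact horner_congr fun k hk => by rw [tupleDigits, Nat.mod_eq_of_lt hk]

theorem iterate_tupleShift_eq_tupleHorner {n : ℕ} {U : D → ℕ} (hp : 0 < p) (hn : n ≠ 0)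
    (hU : ∀ d, U d ≤ p ^ n - 1) (m : ℕ) :
    (tupleShift D p n)^[m] U = tupleHorner D p (fun k => tupleDigits D p n U (k + m)) n := by
  rw [← iterate_tupleShift_tupleHorner (tupleDigits_lt hp U) hn (periodic_tupleDigits n U),
    tupleHorner_tupleDigits hp hU]

theorem mul_dot_iterate_tupleShift {n : ℕ} {U : D → ℕ} (hp : 0 < p) (hn : n ≠ 0)
    (hU : ∀ d, U d ≤ p ^ n - 1) (m : ℕ) :
    p * dot D ((tupleShift D p n)^[m] U) =
      (p ^ n - 1) * dot D (tupleDigits D p n U m) + dot D ((tupleShift D p n)^[m + 1] U) := by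
  rw [iterate_tupleShift_eq_tupleHorner hp hn hU, iterate_tupleShift_eq_tupleHorner hp hn hU,
    mul_dot_tupleHorner_of_periodic hp (by rw [add_comm n m, periodic_tupleDigits, zero_add]),
    zero_add]
  simp only [add_right_comm _ 1 m, add_assoc]

theorem dot_iterate_tupleShift {n : ℕ} {U : D → ℕ} (hp : 0 < p) (hU : U ∈ E D p n) (m : ℕ) :
    dot D ((tupleShift D p n)^[m] U) = (p ^ n - 1) * phiSeq D p n U m := by
  refine (Nat.mul_div_cancel' ?_).symm
  induction m with
  | zero => exact hU.2.1
  | succ m ih =>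
    exact (Nat.dvd_add_right (dvd_mul_right _ _)).1
      (mul_dot_iterate_tupleShift hp (pos_of_mem_E hU).ne' hU.1 m ▸ ih.mul_left p)

theorem isCarrySeq_phiSeq {n : ℕ} {U : D → ℕ} (hp : 1 < p) (hU : U ∈ E D p n) :
    IsCarrySeq D p (tupleDigits D p n U) (phiSeq D p n U) := fun k => by
  have hn := (pos_of_mem_E hU).ne'
  have hq : 1 < p ^ n := Nat.one_lt_pow hn hp
  have h := mul_dot_iterate_tupleShift (by omega) hn hU.1 k
  rw [dot_iterate_tupleShift (by omega) hU, dot_iterate_tupleShift (by omega) hU, mul_left_comm,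
    ← mul_add] at h
  exact (Nat.eq_of_mul_eq_mul_left (by omega) h).symm

theorem periodic_phiSeq {n : ℕ} {U : D → ℕ} (hp : 0 < p) (hU : U ∈ E D p n) :
    (phiSeq D p n U).Periodic n := fun k => by
  have hn := (pos_of_mem_E hU).ne'
  rw [phiSeq, phiSeq, iterate_tupleShift_eq_tupleHorner hp hn hU.1,
    iterate_tupleShift_eq_tupleHorner hp hn hU.1]
  simp only [← add_assoc, periodic_tupleDigits n U _]

theorem phiSeq_pos {n : ℕ} {U : D → ℕ} (hp : 1 < p) (hU : U ∈ E D p n) (k : ℕ) :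
    0 < phiSeq D p n U k := by
  have h0 : 0 < phiSeq D p n U 0 :=
    Nat.pos_of_mul_pos_left (a := p ^ n - 1)
      (dot_iterate_tupleShift (by omega) hU 0 ▸ hU.2.2)
  have hkn : k ≤ k * n := Nat.le_mul_of_pos_right k (pos_of_mem_E hU)
  have hper := (periodic_phiSeq (by omega) hU).nat_mul k 0
  rw [zero_add] at hper
  refine (isCarrySeq_phiSeq hp hU).pos_of_pos_add (m := k * n - k) ?_
  rw [Nat.add_sub_cancel' hkn]
  exact hper ▸ h0

theorem eq_of_periodic_of_modEq {α : Type*} {f : ℕ → α} {n k l : ℕ} (hf : f.Periodic n)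
    (h : k ≡ l [MOD n]) : f k = f l := by
  rw [← hf.map_mod_nat, h, hf.map_mod_nat]

theorem mem_support_iff {n : ℕ} {U : D → ℕ} (hp : 0 < p) (hU : U ∈ E D p n) {v : ℕ} :
    v ∈ support D p n U ↔ ∃ k, phiSeq D p n U k = v := by
  rw [support, Finset.mem_image]
  refine ⟨fun ⟨k, _, hk⟩ => ⟨k, hk⟩, fun ⟨k, hk⟩ => ⟨k % n, ?_, ?_⟩⟩
  · exact Finset.mem_range.2 (Nat.mod_lt _ (pos_of_mem_E hU))
  · rw [(periodic_phiSeq hp hU).map_mod_nat, hk]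

theorem modEq_of_phiSeq_eq {n : ℕ} {U : D → ℕ} (hp : 0 < p) (hU : U ∈ MI D p n) {k l : ℕ}
    (h : phiSeq D p n U k = phiSeq D p n U l) : k ≡ l [MOD n] := by
  have hn := pos_of_mem_E hU.1
  have hinj : Set.InjOn (phiSeq D p n U) (Finset.range n) :=
    Finset.card_image_iff.1 (by rw [Finset.card_range]; exact hU.2.2)
  have hper := periodic_phiSeq hp hU.1
  refine hinj (Finset.mem_coe.2 (Finset.mem_range.2 (Nat.mod_lt _ hn)))
    (Finset.mem_coe.2 (Finset.mem_range.2 (Nat.mod_lt _ hn))) ?_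
  rw [hper.map_mod_nat, hper.map_mod_nat, h]

end Tuple

/-! ### Products of consecutive values of a continuous function -/

section ConsecutiveProducts

open Finset

theorem prod_range_mul_of_periodic {M : Type*} [CommMonoid M] {f : ℕ → M} {q : ℕ}
    (hf : f.Periodic q) (s : ℕ) : ∏ k ∈ range (s * q), f k = (∏ k ∈ range q, f k) ^ s := by
  induction s with
  | zero => simp
  | succ s ih =>
    rw [add_mul, one_mul, prod_range_add, ih, pow_succ]
    exact congrArg _ (prod_congr rfl fun k _ => by rw [add_comm]; exact hf.nat_mul s k)

theorem pow_modEq_one_of_modEq_one {p m : ℕ} {x : ℤ} (hm : m ≠ 0)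
    (hx : x ≡ 1 [ZMOD (p : ℤ) ^ m]) : x ^ p ≡ 1 [ZMOD (p : ℤ) ^ (m + 1)] := by
  have hgeom : (p : ℤ) ∣ ∑ i ∈ range p, x ^ i := by
    have hsum : ∑ i ∈ range p, x ^ i ≡ ∑ i ∈ range p, 1 ^ i [ZMOD p] :=
      Int.ModEq.sum fun i _ => (hx.of_dvd (dvd_pow_self _ hm)).pow i
    exact hsum.dvd_iff.2 (by simp)
  refine (Int.modEq_iff_dvd.2 ?_).symm
  rw [← geom_sum_mul, pow_succ']
  exact mul_dvd_mul hgeom hx.symm.dvd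

theorem prod_range_pow_modEq_one {p : ℕ} {h : ℕ → ℤ} (hone : ∀ a, h a ≡ 1 [ZMOD p])
    (hcont : ∀ m a, h (a + p ^ m) ≡ h a [ZMOD (p : ℤ) ^ (m + 1)]) (m c : ℕ) :
    ∏ k ∈ range (p ^ m), h (c + k) ≡ 1 [ZMOD (p : ℤ) ^ m] := by
  induction m with
  | zero => simp [Int.modEq_one]
  | succ m ih =>
    have hper : Function.Periodic (fun k => (h (c + k) : ZMod (p ^ (m + 1)))) (p ^ m) := fun k => by
      refine (ZMod.intCast_eq_intCast_iff _ _ _).2 ?_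
      rw [← add_assoc, Nat.cast_pow]
      exact hcont m (c + k)
    have hpow : ∏ k ∈ range (p ^ (m + 1)), h (c + k) ≡
        (∏ k ∈ range (p ^ m), h (c + k)) ^ p [ZMOD (p : ℤ) ^ (m + 1)] := by
      have hprod := prod_range_mul_of_periodic hper p
      rw [← pow_succ'] at hprod
      rw [← Nat.cast_pow, ← ZMod.intCast_eq_intCast_iff]
      push_cast
      exact hprod
    refine hpow.trans ?_
    obtain rfl | hm := eq_or_ne m 0
    · simpa using (hone c).pow p
    · exact pow_modEq_one_of_modEq_one hm ih

end ConsecutiveProducts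

/-! ### Norms over an ultrametric field -/

section Ultrametric

variable {K : Type*} [NormedField K] [IsUltrametricDist K]

theorem norm_sub_le_of_le {x y : K} {C : ℝ} (hx : ‖x‖ ≤ C) (hy : ‖y‖ ≤ C) : ‖x - y‖ ≤ C := by
  rw [sub_eq_add_neg]
  exact (IsUltrametricDist.norm_add_le_max x (-y)).trans (max_le hx (by rwa [norm_neg]))

theorem norm_intCast_le_pow_of_dvd {p m : ℕ} {z : ℤ} (h : (p : ℤ) ^ m ∣ z) :
    ‖(z : K)‖ ≤ ‖(p : K)‖ ^ m := by
  obtain ⟨y, rfl⟩ := h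
  push_cast
  rw [norm_mul, norm_pow]
  exact mul_le_of_le_one_right (by positivity) (IsUltrametricDist.norm_intCast_le_one K y)

theorem norm_intCast_eq_one_of_isCoprime {p : ℕ} (hp : ‖(p : K)‖ < 1) {z : ℤ}
    (h : IsCoprime z p) : ‖(z : K)‖ = 1 := by
  refine le_antisymm (IsUltrametricDist.norm_intCast_le_one K z) ?_
  obtain ⟨x, y, hxy⟩ := h
  have hone : (x : K) * z + y * p = 1 := by exact_mod_cast congrArg (Int.cast : ℤ → K) hxy
  have hmax := IsUltrametricDist.norm_add_le_max ((x : K) * z) (y * p)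
  rw [hone, norm_one, norm_mul, norm_mul] at hmax
  have hx := IsUltrametricDist.norm_intCast_le_one K x
  have hy := IsUltrametricDist.norm_intCast_le_one K y
  obtain hz | hp' := le_max_iff.1 hmax
  · exact hz.trans (mul_le_of_le_one_left (norm_nonneg _) hx)
  · exact absurd (hp'.trans (mul_le_of_le_one_left (norm_nonneg _) hy)) hp.not_ge

theorem norm_factorial_eq_one_of_lt {p : ℕ} [hp : Fact p.Prime] (hpK : ‖(p : K)‖ < 1) {t : ℕ}
    (ht : t < p) : ‖(t.factorial : K)‖ = 1 := by
  have hcop : Nat.Coprime t.factorial p :=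
    ((hp.out.coprime_iff_not_dvd).2 fun h => ht.not_ge (hp.out.dvd_factorial.1 h)).symm
  exact_mod_cast norm_intCast_eq_one_of_isCoprime hpK (Nat.isCoprime_iff_coprime.2 hcop)

end Ultrametric

/-! ### Iterated differences -/

section Differences

open Finset

theorem fwdDiff_iter_shift_sub {G : Type*} [AddCommGroup G] (f : ℕ → G) (q l a : ℕ) :
    (fwdDiff 1)^[l] (fun b => f (b + q) - f b) a =
      (fwdDiff 1)^[l] f (a + q) - (fwdDiff 1)^[l] f a := by
  simp only [fwdDiff_iter_eq_sum_shift, smul_sub, sum_sub_distrib, add_right_comm a _ q]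

theorem fwdDiff_iter_eq_shift_sub_sub_sum {G : Type*} [AddCommGroup G] (f : ℕ → G) (r a : ℕ) :
    (fwdDiff 1)^[r + 1] f a = f (a + (r + 1)) - f a -
      ∑ i ∈ range r, (r + 1).choose (i + 1) • (fwdDiff 1)^[i + 1] f a := by
  have h := shift_eq_sum_fwdDiff_iter 1 f (r + 1) a
  rw [sum_range_succ, sum_range_succ'] at h
  simp only [smul_eq_mul, mul_one, Nat.choose_self, Nat.choose_zero_right, one_smul,
    Function.iterate_zero, id_eq] at h
  rw [h]
  abel

variable {K : Type*} [NormedField K] [IsUltrametricDist K]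

theorem norm_fwdDiff_iter_le {f : ℕ → K} {C : ℝ} (hf : ∀ a, ‖f a‖ ≤ C) (k a : ℕ) :
    ‖(fwdDiff 1)^[k] f a‖ ≤ C := by
  induction k generalizing a with
  | zero => exact hf a
  | succ k ih =>
    rw [Function.iterate_succ_apply', fwdDiff]
    exact norm_sub_le_of_le (ih _) (ih _)

theorem norm_fwdDiff_iter_pow_le {p : ℕ} [hp : Fact p.Prime] {f : ℕ → K} {C : ℝ} {m : ℕ}
    (hf : ∀ a, ‖f a‖ ≤ C) (hc : ∀ a, ‖f (a + p ^ m) - f a‖ ≤ ‖(p : K)‖ * C) (a : ℕ) :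
    ‖(fwdDiff 1)^[p ^ m] f a‖ ≤ ‖(p : K)‖ * C := by
  have hC : 0 ≤ C := (norm_nonneg _).trans (hf 0)
  obtain ⟨r, hr⟩ : ∃ r, p ^ m = r + 1 :=
    Nat.exists_eq_succ_of_ne_zero (pow_ne_zero m hp.out.ne_zero)
  rw [hr, fwdDiff_iter_eq_shift_sub_sub_sum, ← hr]
  refine norm_sub_le_of_le (hc a)
    (IsUltrametricDist.norm_sum_le_of_forall_le_of_nonneg (by positivity) fun i hi => ?_)
  rw [mem_range] at hi
  have hdvd : p ∣ (p ^ m).choose (i + 1) := hp.out.dvd_choose_pow (by omega) (by omega)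
  have hchoose : ‖(((p ^ m).choose (i + 1) : ℤ) : K)‖ ≤ ‖(p : K)‖ ^ 1 :=
    norm_intCast_le_pow_of_dvd (by simpa using Int.natCast_dvd_natCast.2 hdvd)
  rw [pow_one, Int.cast_natCast] at hchoose
  rw [nsmul_eq_mul, norm_mul]
  exact mul_le_mul hchoose (norm_fwdDiff_iter_le hf _ _) (norm_nonneg _) (norm_nonneg _)

/-- This is the convergence half of Mahler's theorem. -/
theorem exists_forall_norm_fwdDiff_iter_le {p : ℕ} [hp : Fact p.Prime] {f : ℕ → K}
    (hf : ∀ a, ‖f a‖ ≤ 1) (hc : ∀ m a, ‖f (a + p ^ m) - f a‖ ≤ ‖(p : K)‖ ^ m) (m : ℕ) :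
    ∃ n, ∀ k ≥ n, ∀ a, ‖(fwdDiff 1)^[k] f a‖ ≤ ‖(p : K)‖ ^ m := by
  induction m with
  | zero => exact ⟨0, fun k _ a => by simpa using norm_fwdDiff_iter_le hf k a⟩
  | succ m ih =>
    obtain ⟨n, hn⟩ := ih
    refine ⟨p ^ (m + 1) + n, fun k hk a => ?_⟩
    obtain ⟨l, rfl⟩ := Nat.exists_eq_add_of_le ((Nat.le_add_right _ n).trans hk)
    rw [Function.iterate_add_apply, pow_succ' ‖(p : K)‖]
    refine norm_fwdDiff_iter_pow_le (hn l (by omega)) (fun b => ?_) a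
    rw [← fwdDiff_iter_shift_sub, ← pow_succ']
    exact norm_fwdDiff_iter_le (hc (m + 1)) l b

end Differences

/-! ### Factorials and powers of `π` -/

section Factorials

open Finset

/-- The product, up to sign, of the prime-to-`p` integers among
`p a + t + 1, …, p (a + 1) + t`. -/
def unitBlock (p t a : ℕ) : ℤ :=
  -((∏ i ∈ Ico (t + 1) p, ((p : ℤ) * a + i)) * ∏ i ∈ Ico 1 (t + 1), ((p : ℤ) * (a + 1) + i))

theorem unitBlock_modEq_one {p : ℕ} [Fact p.Prime] {t : ℕ} (ht : t < p) (a : ℕ) :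
    unitBlock p t a ≡ 1 [ZMOD p] := by
  rw [← ZMod.intCast_eq_intCast_iff]
  simp only [unitBlock, Int.cast_neg, Int.cast_mul, Int.cast_prod, Int.cast_add, Int.cast_natCast,
    CharP.cast_eq_zero, zero_mul, zero_add, Int.cast_one]
  rw [mul_comm, prod_Ico_consecutive _ (by omega) (by omega), ZMod.prod_Ico_one_prime, neg_neg]

theorem unitBlock_add_pow (p t m a : ℕ) :
    unitBlock p t (a + p ^ m) ≡ unitBlock p t a [ZMOD (p : ℤ) ^ (m + 1)] := by
  refine (Int.ModEq.mul (Int.ModEq.prod fun i _ => ?_) (Int.ModEq.prod fun i _ => ?_)).neg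
  all_goals
    refine Int.ModEq.add_right _ (Int.modEq_iff_dvd.2 ⟨-1, ?_⟩)
    push_cast
    ring

theorem factorial_add_eq_mul_prod (N : ℕ) {a b : ℕ} (hab : a ≤ b) :
    (N + b).factorial = (N + a).factorial * ∏ i ∈ Ico (a + 1) (b + 1), (N + i) := by
  induction b, hab using Nat.le_induction with
  | base => simp
  | succ b hab ih =>
    rw [← add_assoc, Nat.factorial_succ, ih, prod_Ico_succ_top (by omega : a + 1 ≤ b + 1)]
    ring

theorem factorial_mul_succ_add {p t : ℕ} (ht : t < p) (a : ℕ) :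
    ((p * (a + 1) + t).factorial : ℤ) =
      -((p * a + t).factorial * (p * (a + 1)) * unitBlock p t a) := by
  have hlow := factorial_add_eq_mul_prod (p * a) (show t ≤ p - 1 by omega)
  have hhigh := factorial_add_eq_mul_prod (p * (a + 1)) (Nat.zero_le t)
  have hmul : (p * (a + 1)).factorial = p * (a + 1) * (p * a + (p - 1)).factorial := by
    have : p * (a + 1) = p * a + (p - 1) + 1 := by rw [mul_add]; omega
    rw [this, Nat.factorial_succ]
  rw [show p - 1 + 1 = p by omega] at hlow
  rw [add_zero, hmul, hlow, zero_add] at hhigh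
  rw [hhigh, unitBlock]
  push_cast
  ring

/-- The quotient `(-p) ^ a a! / (p a + t)!`, for a digit `t`: the unit which compares
`π ^ (p a + t) / (p a + t)!` with `π ^ t π ^ a / a!`. -/
noncomputable def factorialQuotient (K : Type*) [Field K] (p t a : ℕ) : K :=
  (-(p : K)) ^ a * a.factorial / (p * a + t).factorial

theorem factorialQuotient_zero (K : Type*) [Field K] (p t : ℕ) :
    factorialQuotient K p t 0 = (t.factorial : K)⁻¹ := by
  simp [factorialQuotient]

theorem factorialQuotient_succ {K : Type*} [Field K] [CharZero K] {p t : ℕ} (ht : t < p) (a : ℕ) :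
    factorialQuotient K p t (a + 1) * (unitBlock p t a : K) = factorialQuotient K p t a := by
  have hfact := congrArg (Int.cast : ℤ → K) (factorial_mul_succ_add ht a)
  have hne : ∀ n : ℕ, (n.factorial : K) ≠ 0 := fun n =>
    Nat.cast_ne_zero.2 (Nat.factorial_ne_zero n)
  have hne' := hne (p * (a + 1) + t)
  push_cast at hfact
  rw [hfact] at hne'
  have hblock : (unitBlock p t a : K) ≠ 0 := fun h => hne' (by rw [h]; ring)
  have hpa : (p : K) * (a + 1) ≠ 0 := fun h => hne' (by rw [h]; ring)
  have := hne (p * a + t)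
  rw [factorialQuotient, factorialQuotient, hfact, Nat.factorial_succ, Nat.cast_mul, Nat.cast_succ]
  field_simp [left_ne_zero_of_mul hpa, right_ne_zero_of_mul hpa]
  ring

theorem factorialQuotient_add {K : Type*} [Field K] [CharZero K] {p t : ℕ} (ht : t < p)
    (a n : ℕ) :
    factorialQuotient K p t (a + n) * ((∏ k ∈ range n, unitBlock p t (a + k) : ℤ) : K) =
      factorialQuotient K p t a := by
  induction n with
  | zero => simp
  | succ n ih =>
    rw [prod_range_succ, ← ih, ← factorialQuotient_succ ht (a + n), ← add_assoc]
    push_cast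
    ring

variable {K : Type*} [NormedField K] {p : ℕ} {ϖ : K}

theorem pow_div_factorial_mul_add [CharZero K] (hϖ : ϖ ^ (p - 1) = -(p : K)) (hp : 0 < p)
    (a t : ℕ) :
    ϖ ^ (p * a + t) / (p * a + t).factorial =
      ϖ ^ t * (ϖ ^ a / a.factorial) * factorialQuotient K p t a := by
  have hfact : (a.factorial : K) ≠ 0 := Nat.cast_ne_zero.2 (Nat.factorial_ne_zero _)
  have hexp : p * a + t = t + a + (p - 1) * a := by
    rw [Nat.sub_mul, one_mul]
    have := Nat.le_mul_of_pos_left a hp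
    omega
  have hpow : ϖ ^ (p * a + t) = ϖ ^ t * ϖ ^ a * (-(p : K)) ^ a := by
    rw [hexp, pow_add, pow_add, pow_mul, hϖ]
  rw [factorialQuotient, hpow]
  field_simp

theorem norm_uniformizer_lt_one (hp : 1 < p) (hpK : ‖(p : K)‖ < 1) (hϖ : ϖ ^ (p - 1) = -(p : K)) :
    ‖ϖ‖ < 1 := by
  have h := congrArg norm hϖ
  rw [norm_pow, norm_neg] at h
  exact (pow_lt_one_iff_of_nonneg (norm_nonneg _) (by omega)).1 (h ▸ hpK)

theorem norm_natCast_le_norm_uniformizer (hp : 1 < p) (hpK : ‖(p : K)‖ < 1)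
    (hϖ : ϖ ^ (p - 1) = -(p : K)) : ‖(p : K)‖ ≤ ‖ϖ‖ := by
  rw [← norm_neg, ← hϖ, norm_pow]
  exact pow_le_of_le_one (norm_nonneg _) (norm_uniformizer_lt_one hp hpK hϖ).le (by omega)

variable [Fact p.Prime] [CharZero K] [IsUltrametricDist K]

theorem norm_factorialQuotient (hpK : ‖(p : K)‖ < 1) {t : ℕ} (ht : t < p) (a : ℕ) :
    ‖factorialQuotient K p t a‖ = 1 := by
  have hunit : ∀ b, ‖(unitBlock p t b : K)‖ = 1 := fun b =>
    norm_intCast_eq_one_of_isCoprime hpK <| by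
      obtain ⟨y, hy⟩ := (unitBlock_modEq_one ht b).dvd
      exact ⟨1, y, by linear_combination -hy⟩
  have h := congrArg norm (factorialQuotient_add (K := K) ht 0 a)
  rw [norm_mul, Int.cast_prod, norm_prod, prod_congr rfl fun k _ => hunit (0 + k), prod_const_one,
    mul_one, zero_add, factorialQuotient_zero, norm_inv, norm_factorial_eq_one_of_lt hpK ht,
    inv_one] at h
  exact h

theorem norm_factorialQuotient_add_sub_le (hpK : ‖(p : K)‖ < 1) {t : ℕ} (ht : t < p) {m a n : ℕ}
    (h : ∏ k ∈ range n, unitBlock p t (a + k) ≡ 1 [ZMOD (p : ℤ) ^ m]) :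
    ‖factorialQuotient K p t (a + n) - factorialQuotient K p t a‖ ≤ ‖(p : K)‖ ^ m := by
  rw [← factorialQuotient_add ht a n, ← mul_one_sub, norm_mul, norm_factorialQuotient hpK ht,
    one_mul]
  exact_mod_cast norm_intCast_le_pow_of_dvd (K := K) h.dvd

theorem norm_factorialQuotient_add_pow_sub (hpK : ‖(p : K)‖ < 1) {t : ℕ} (ht : t < p) (m a : ℕ) :
    ‖factorialQuotient K p t (a + p ^ m) - factorialQuotient K p t a‖ ≤ ‖(p : K)‖ ^ m :=
  norm_factorialQuotient_add_sub_le hpK ht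
    (prod_range_pow_modEq_one (unitBlock_modEq_one ht) (unitBlock_add_pow p t) m a)

theorem norm_factorialQuotient_succ_sub (hpK : ‖(p : K)‖ < 1) {t : ℕ} (ht : t < p) (a : ℕ) :
    ‖factorialQuotient K p t (a + 1) - factorialQuotient K p t a‖ ≤ ‖(p : K)‖ := by
  rw [← pow_one ‖(p : K)‖]
  exact norm_factorialQuotient_add_sub_le hpK ht (by simpa using unitBlock_modEq_one ht a)

theorem norm_pow_div_factorial (hpK : ‖(p : K)‖ < 1) (hϖ : ϖ ^ (p - 1) = -(p : K)) (a : ℕ) :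
    ‖ϖ ^ a / (a.factorial : K)‖ = ‖ϖ‖ ^ weight p a := by
  have hp := (Fact.out : p.Prime).one_lt
  induction a using Nat.strong_induction_on with
  | _ a ih =>
    obtain rfl | ha := Nat.eq_zero_or_pos a
    · simp [weight_zero]
    have hmod := Nat.mod_lt a (show 0 < p by omega)
    have h := pow_div_factorial_mul_add hϖ (by omega) (a / p) (a % p)
    rw [Nat.div_add_mod] at h
    rw [h, norm_mul, norm_mul, ih _ (Nat.div_lt_self ha hp), norm_factorialQuotient hpK hmod,
      norm_pow, mul_one, mul_comm, ← pow_add, weight_div_add_mod hp]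

end Factorials

/-! ### Coefficients of the splitting function -/

section PowerSeries

open Finset PowerSeries

variable {K : Type*} [Field K]

theorem coeff_subst_C_mul_X_pow {d : ℕ} (hd : 0 < d) (f : PowerSeries K) (a : K) (n : ℕ) :
    coeff n (f.subst (C a * X ^ d)) = if d ∣ n then a ^ (n / d) * coeff (n / d) f else 0 := by
  have hs : HasSubst (C a * X ^ d : PowerSeries K) :=
    .of_constantCoeff_zero' (by simp [hd.ne'])
  have hterm : ∀ k, coeff k f • coeff n ((C a * X ^ d : PowerSeries K) ^ k) =
      if n = d * k then a ^ k * coeff k f else 0 := fun k => by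
    rw [mul_pow, ← map_pow, ← pow_mul, coeff_C_mul, coeff_X_pow]
    split_ifs <;> simp [mul_comm]
  rw [coeff_subst' hs, finsum_congr hterm]
  split_ifs with h
  · obtain ⟨m, rfl⟩ := h
    rw [Nat.mul_div_cancel_left _ hd, finsum_eq_single _ m fun k hk => if_neg fun h =>
      hk (Nat.eq_of_mul_eq_mul_left hd h).symm, if_pos rfl]
  · exact finsum_eq_zero_of_forall_eq_zero fun k => if_neg fun hk => h ⟨k, hk⟩

variable [CharZero K]

theorem eq_of_derivative_eq_mul {f g h : PowerSeries K} (hf : derivative K f = f * h)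
    (hg : derivative K g = g * h) (hfg : constantCoeff f = constantCoeff g)
    (hg0 : constantCoeff g ≠ 0) : f = g := by
  have hinv : g * g⁻¹ = 1 := PowerSeries.mul_inv_cancel g hg0
  have hquot : f * g⁻¹ = 1 := by
    apply derivative.ext
    · rw [Derivation.leibniz, derivative_inv', hf, hg, Derivation.map_one_eq_zero]
      simp only [smul_eq_mul]
      linear_combination -f * h * g⁻¹ * hinv
    · rw [map_mul, hfg, ← map_mul, hinv]
  calc f = f * g⁻¹ * g := by linear_combination -f * hinv
    _ = g := by rw [hquot, one_mul]

theorem constantCoeff_exp_subst {g : PowerSeries K} (hg : constantCoeff g = 0) :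
    constantCoeff ((exp K).subst g) = 1 := by
  rw [← coeff_zero_eq_constantCoeff_apply, coeff_subst' (.of_constantCoeff_zero' hg),
    finsum_eq_single _ 0 fun n hn => by simp [hg, hn]]
  simp

theorem derivative_exp_subst {g : PowerSeries K} (hg : constantCoeff g = 0) :
    derivative K ((exp K).subst g) = (exp K).subst g * derivative K g := by
  rw [derivative_subst (.of_constantCoeff_zero' hg), derivative_exp]

theorem exp_subst_add {g h : PowerSeries K} (hg : constantCoeff g = 0)
    (hh : constantCoeff h = 0) :
    (exp K).subst (g + h) = (exp K).subst g * (exp K).subst h := by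
  have hgh : constantCoeff (g + h) = 0 := by simp [hg, hh]
  have hone : constantCoeff ((exp K).subst g * (exp K).subst h) = 1 := by
    rw [map_mul, constantCoeff_exp_subst hg, constantCoeff_exp_subst hh, one_mul]
  refine eq_of_derivative_eq_mul (derivative_exp_subst hgh) ?_
    ((constantCoeff_exp_subst hgh).trans hone.symm) (hone ▸ one_ne_zero)
  rw [Derivation.leibniz, derivative_exp_subst hg, derivative_exp_subst hh, map_add]
  simp only [smul_eq_mul]
  ring

theorem theta_eq_mul {p : ℕ} (hp : 0 < p) (ϖ : K) :
    theta p ϖ = (exp K).subst (C ϖ * X ^ 1) * (exp K).subst (C (-ϖ) * X ^ p) := by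
  rw [theta, ← exp_subst_add (by simp) (by simp [hp.ne'])]
  congr 1
  simp only [map_neg, pow_one]
  ring

theorem sum_antidiagonal_mul_add {M : Type*} [AddCommMonoid M] {p t : ℕ} (ht : t < p) (n : ℕ)
    {f : ℕ × ℕ → M} (hf : ∀ x, ¬ p ∣ x.2 → f x = 0) :
    ∑ x ∈ antidiagonal (p * n + t), f x =
      ∑ x ∈ antidiagonal n, f (p * x.1 + t, p * x.2) := by
  have hp : 0 < p := by omega
  refine (sum_of_injOn (fun x : ℕ × ℕ => (p * x.1 + t, p * x.2)) ?_ ?_ ?_ fun _ _ => rfl).symm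
  · rintro ⟨a, b⟩ - ⟨a', b'⟩ - h
    simp only [Prod.mk.injEq, add_left_inj] at h
    exact Prod.ext (Nat.eq_of_mul_eq_mul_left hp h.1) (Nat.eq_of_mul_eq_mul_left hp h.2)
  · rintro ⟨a, b⟩ h
    simp only [mem_coe, HasAntidiagonal.mem_antidiagonal] at h ⊢
    rw [← h]
    ring
  · rintro ⟨i, l⟩ h hne
    rw [HasAntidiagonal.mem_antidiagonal] at h
    refine hf _ ?_
    rintro ⟨b, rfl⟩
    have hb : b ≤ n := Nat.lt_succ_iff.1 <| (Nat.mul_lt_mul_left hp).1 <| by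
      rw [Nat.mul_succ]
      omega
    obtain ⟨a, rfl⟩ := Nat.exists_eq_add_of_le' hb
    refine hne ⟨(a, b), by simp, Prod.ext (?_ : p * a + t = i) rfl⟩
    rw [mul_add] at h
    omega

theorem coeff_theta_mul_add {p t : ℕ} (ht : t < p) (ϖ : K) (n : ℕ) :
    coeff (p * n + t) (theta p ϖ) = ∑ x ∈ antidiagonal n,
      ϖ ^ (p * x.1 + t) / (p * x.1 + t).factorial * ((-ϖ) ^ x.2 / x.2.factorial) := by
  have hp : 0 < p := by omega
  rw [theta_eq_mul hp, coeff_mul, sum_antidiagonal_mul_add ht n fun x hx => by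
    rw [coeff_subst_C_mul_X_pow hp, if_neg hx, mul_zero]]
  refine sum_congr rfl fun x _ => ?_
  rw [coeff_subst_C_mul_X_pow hp, coeff_subst_C_mul_X_pow one_pos]
  simp [hp, coeff_exp, div_eq_mul_inv]

theorem coeff_F₁ {p : ℕ} (ϖ : K) {D : Finset ℕ} (hpos : ∀ d ∈ D, 0 < d) (a : D → K) {n B : ℕ}
    (hB : n < B) :
    coeff n (F₁ p ϖ D a) =
      ∑ u ∈ (Fintype.piFinset fun _ : D => range B) with dot D u = n,
        ∏ d : D, (a d ^ u d * coeff (u d) (theta p ϖ)) := by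
  classical
  rw [F₁, coeff_prod]
  symm
  refine sum_of_injOn (fun u => Finsupp.equivFunOnFinite.symm fun d : D => (d : ℕ) * u d)
    ?_ ?_ ?_ ?_
  · intro u _ v _ h
    have h := Finsupp.equivFunOnFinite.symm.injective h
    exact funext fun d => Nat.eq_of_mul_eq_mul_left (hpos d d.2) (congrFun h d)
  · intro u hu
    rw [mem_coe, mem_filter] at hu
    rw [mem_coe, mem_finsuppAntidiag]
    exact ⟨hu.2, subset_univ _⟩
  · intro l hl hne
    rw [mem_finsuppAntidiag] at hl
    by_contra hprod
    have hdvd : ∀ d : D, (d : ℕ) ∣ l d := fun d => by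
      have hcoeff := prod_ne_zero_iff.1 hprod d (mem_univ d)
      rw [coeff_subst_C_mul_X_pow (hpos d d.2)] at hcoeff
      by_contra hd
      exact hcoeff (if_neg hd)
    have hquot : ∀ d : D, (d : ℕ) * (l d / d) = l d := fun d => Nat.mul_div_cancel' (hdvd d)
    refine hne ⟨fun d => l d / d, ?_, Finsupp.ext hquot⟩
    rw [mem_coe, mem_filter, Fintype.mem_piFinset]
    simp only [mem_range, dot, hquot]
    refine ⟨fun d => ((Nat.div_le_self _ _).trans ?_).trans_lt hB, hl.1⟩
    exact hl.1 ▸ single_le_sum (f := fun d => l d) (fun _ _ => Nat.zero_le _) (mem_univ d)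
  · intro u _
    refine prod_congr rfl fun d _ => ?_
    rw [coeff_subst_C_mul_X_pow (hpos d d.2)]
    simp [Nat.mul_div_cancel_left _ (hpos d d.2)]

end PowerSeries

/-! ### Sizes of the coefficients of the splitting function -/

section CoefficientNorms

open Finset PowerSeries Filter Topology

variable {K : Type*} [NormedField K]

theorem norm_pow_mul_le {a x : K} (ha : ‖a‖ ≤ 1) (n : ℕ) : ‖a ^ n * x‖ ≤ ‖x‖ := by
  rw [norm_mul, norm_pow]
  exact mul_le_of_le_one_left (norm_nonneg _) (pow_le_one₀ (norm_nonneg _) ha)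

variable [CharZero K] {p : ℕ} {ϖ : K}

theorem coeff_theta_eq_fwdDiff (hϖ : ϖ ^ (p - 1) = -(p : K)) {t : ℕ} (ht : t < p) (n : ℕ) :
    coeff (p * n + t) (theta p ϖ) =
      ϖ ^ t * (ϖ ^ n / n.factorial) * (fwdDiff 1)^[n] (factorialQuotient K p t) 0 := by
  rw [coeff_theta_mul_add ht, fwdDiff_iter_eq_sum_shift, Nat.sum_antidiagonal_eq_sum_range_succ_mk,
    mul_sum]
  refine sum_congr rfl fun a ha => ?_
  obtain ⟨b, rfl⟩ := Nat.exists_eq_add_of_le (Nat.lt_succ_iff.1 (mem_range.1 ha))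
  have hfact : ∀ n : ℕ, (n.factorial : K) ≠ 0 := fun n =>
    Nat.cast_ne_zero.2 (Nat.factorial_ne_zero n)
  have ha0 := hfact a
  have hb0 := hfact b
  have hab0 := hfact (a + b)
  rw [pow_div_factorial_mul_add hϖ (by omega), Nat.add_sub_cancel_left, zsmul_eq_mul,
    Int.cast_mul, Int.cast_natCast, Nat.cast_add_choose, neg_pow ϖ b, pow_add ϖ a b]
  simp only [smul_eq_mul, mul_one, zero_add, Int.cast_pow, Int.cast_neg, Int.cast_one]
  field_simp

theorem coeff_theta_of_lt (hϖ : ϖ ^ (p - 1) = -(p : K)) {t : ℕ} (ht : t < p) :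
    coeff t (theta p ϖ) = ϖ ^ t / t.factorial := by
  simpa [factorialQuotient_zero, div_eq_mul_inv] using coeff_theta_eq_fwdDiff hϖ ht 0

variable [Fact p.Prime] [IsUltrametricDist K]

theorem norm_coeff_theta (hpK : ‖(p : K)‖ < 1) (hϖ : ϖ ^ (p - 1) = -(p : K)) (u : ℕ) :
    ‖coeff u (theta p ϖ)‖ =
      ‖ϖ‖ ^ weight p u * ‖(fwdDiff 1)^[u / p] (factorialQuotient K p (u % p)) 0‖ := by
  have hp := (Fact.out : p.Prime).one_lt
  have h := coeff_theta_eq_fwdDiff hϖ (Nat.mod_lt u (by omega)) (u / p)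
  rw [Nat.div_add_mod] at h
  rw [h, norm_mul, norm_mul, norm_pow_div_factorial hpK hϖ, norm_pow, ← pow_add, add_comm,
    weight_div_add_mod hp]

theorem norm_coeff_theta_le (hpK : ‖(p : K)‖ < 1) (hϖ : ϖ ^ (p - 1) = -(p : K)) (u : ℕ) :
    ‖coeff u (theta p ϖ)‖ ≤ ‖ϖ‖ ^ weight p u := by
  have hmod := Nat.mod_lt u (Fact.out : p.Prime).pos
  rw [norm_coeff_theta hpK hϖ]
  exact mul_le_of_le_one_right (by positivity)
    (norm_fwdDiff_iter_le (fun a => (norm_factorialQuotient hpK hmod a).le) _ _)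

theorem norm_coeff_theta_le_of_le (hpK : ‖(p : K)‖ < 1) (hϖ : ϖ ^ (p - 1) = -(p : K)) {u : ℕ}
    (hu : p ≤ u) : ‖coeff u (theta p ϖ)‖ ≤ ‖ϖ‖ ^ (weight p u + 1) := by
  have hp := (Fact.out : p.Prime).one_lt
  have hmod := Nat.mod_lt u (show 0 < p by omega)
  obtain ⟨n, hn⟩ := Nat.exists_eq_succ_of_ne_zero (Nat.div_pos hu (by omega)).ne'
  rw [norm_coeff_theta hpK hϖ, pow_succ, hn, Function.iterate_succ_apply]
  refine mul_le_mul_of_nonneg_left ?_ (by positivity)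
  exact (norm_fwdDiff_iter_le (norm_factorialQuotient_succ_sub hpK hmod) _ _).trans
    (norm_natCast_le_norm_uniformizer hp hpK hϖ)

theorem tendsto_coeff_theta (hpK : ‖(p : K)‖ < 1) (hϖ : ϖ ^ (p - 1) = -(p : K)) :
    Tendsto (fun u => coeff u (theta p ϖ)) atTop (𝓝 0) := by
  have hp := (Fact.out : p.Prime).one_lt
  rw [Metric.tendsto_atTop]
  intro ε hε
  obtain ⟨m, hm⟩ := exists_pow_lt_of_lt_one hε hpK
  choose! n hn using fun t (ht : t < p) => exists_forall_norm_fwdDiff_iter_le (p := p)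
    (fun a => (norm_factorialQuotient (K := K) hpK ht a).le)
    (norm_factorialQuotient_add_pow_sub hpK ht) m
  refine ⟨p * ∑ t ∈ range p, n t, fun u hu => ?_⟩
  have hmod := Nat.mod_lt u (show 0 < p by omega)
  have hle : n (u % p) ≤ u / p := by
    rw [Nat.le_div_iff_mul_le (by omega), mul_comm]
    exact (Nat.mul_le_mul_left _
      (single_le_sum (fun _ _ => Nat.zero_le _) (mem_range.2 hmod))).trans hu
  rw [dist_zero_right, norm_coeff_theta hpK hϖ]
  calc _ ≤ 1 * ‖(fwdDiff 1)^[u / p] (factorialQuotient K p (u % p)) 0‖ := by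
        gcongr
        exact pow_le_one₀ (norm_nonneg _) (norm_uniformizer_lt_one hp hpK hϖ).le
    _ ≤ ‖(p : K)‖ ^ m := by
        rw [one_mul]
        exact hn _ hmod _ hle 0
    _ < ε := hm

theorem norm_pow_mul_coeff_theta_le_one (hpK : ‖(p : K)‖ < 1) (hϖ : ϖ ^ (p - 1) = -(p : K)) {a : K}
    (ha : ‖a‖ ≤ 1) (u : ℕ) : ‖a ^ u * coeff u (theta p ϖ)‖ ≤ 1 :=
  (norm_pow_mul_le ha u).trans <| (norm_coeff_theta_le hpK hϖ u).trans <|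
    pow_le_one₀ (norm_nonneg _)
      (norm_uniformizer_lt_one (Fact.out : p.Prime).one_lt hpK hϖ).le

variable {D : Finset ℕ} {a : D → K}

theorem norm_coeff_F₁_le_one (hpK : ‖(p : K)‖ < 1) (hϖ : ϖ ^ (p - 1) = -(p : K))
    (hpos : ∀ d ∈ D, 0 < d) (ha : ∀ d, ‖a d‖ ≤ 1) (n : ℕ) : ‖coeff n (F₁ p ϖ D a)‖ ≤ 1 := by
  rw [coeff_F₁ ϖ hpos a (Nat.lt_succ_self n)]
  refine IsUltrametricDist.norm_sum_le_of_forall_le_of_nonneg zero_le_one fun u _ => ?_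
  rw [norm_prod]
  exact prod_le_one (fun _ _ => norm_nonneg _) fun d _ =>
    norm_pow_mul_coeff_theta_le_one hpK hϖ (ha d) (u d)

theorem exists_lt_of_mul_lt_dot {u : D → ℕ} {B : ℕ} (h : (∑ d : D, (d : ℕ)) * B < dot D u) :
    ∃ d, B < u d := by
  by_contra! hu
  refine h.not_ge ?_
  rw [dot, sum_mul]
  exact sum_le_sum fun d _ => Nat.mul_le_mul_left _ (hu d)

theorem tendsto_coeff_F₁ (hpK : ‖(p : K)‖ < 1) (hϖ : ϖ ^ (p - 1) = -(p : K))
    (hpos : ∀ d ∈ D, 0 < d) (ha : ∀ d, ‖a d‖ ≤ 1) :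
    Tendsto (fun n => coeff n (F₁ p ϖ D a)) atTop (𝓝 0) := by
  rw [Metric.tendsto_atTop]
  intro ε hε
  obtain ⟨B, hB⟩ := Metric.tendsto_atTop.1 (tendsto_coeff_theta hpK hϖ) (ε / 2) (half_pos hε)
  refine ⟨(∑ d : D, (d : ℕ)) * B + 1, fun n hn => ?_⟩
  rw [dist_zero_right, coeff_F₁ ϖ hpos a (Nat.lt_succ_self n)]
  refine (IsUltrametricDist.norm_sum_le_of_forall_le_of_nonneg (half_pos hε).le
    fun u hu => ?_).trans_lt (half_lt_self hε)
  have hdot : dot D u = n := (mem_filter.1 hu).2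
  obtain ⟨d₀, hd₀⟩ := exists_lt_of_mul_lt_dot (show (∑ d : D, (d : ℕ)) * B < dot D u by omega)
  have hsmall := hB _ hd₀.le
  rw [dist_zero_right] at hsmall
  rw [norm_prod, ← mul_prod_erase _ _ (mem_univ d₀)]
  calc _ ≤ ‖a d₀ ^ u d₀ * coeff (u d₀) (theta p ϖ)‖ :=
        mul_le_of_le_one_right (norm_nonneg _) <|
          prod_le_one (fun _ _ => norm_nonneg _) fun d _ =>
            norm_pow_mul_coeff_theta_le_one hpK hϖ (ha d) (u d)
    _ ≤ ‖coeff (u d₀) (theta p ϖ)‖ := norm_pow_mul_le (ha d₀) _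
    _ ≤ ε / 2 := hsmall.le

end CoefficientNorms

/-! ### Existence of Fredholm determinants -/

section Fredholm

open Finset Filter Topology

variable {ι : Type*}

theorem coeff_charpolyRev_eq_sum_minors {R : Type*} [CommRing R] [Fintype ι] [DecidableEq ι]
    (M : Matrix ι ι R) (n : ℕ) :
    M.charpolyRev.coeff n =
      (-1) ^ n *
        ∑ s ∈ univ.powersetCard n, (M.submatrix (Subtype.val : s → ι) Subtype.val).det := by
  have hneg : M.charpolyRev =
      Matrix.det (1 + (Polynomial.X : Polynomial R) • (-M).map Polynomial.C) := by
    rw [Matrix.charpolyRev, sub_eq_add_neg, Matrix.map_neg Polynomial.C (map_neg Polynomial.C) M,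
      smul_neg]
  rw [hneg, Matrix.coeff_det_one_add_X_smul_eq_sum_minors, mul_sum]
  refine sum_congr rfl fun s hs => ?_
  rw [Matrix.submatrix_neg, Pi.neg_apply, Pi.neg_apply, Matrix.det_neg, Fintype.card_coe,
    (mem_powersetCard.1 hs).2]

theorem coeff_charpolyRev_submatrix {R : Type*} [CommRing R] [DecidableEq ι] (A : Matrix ι ι R)
    (S : Finset ι) (n : ℕ) :
    (A.submatrix (Subtype.val : S → ι) Subtype.val).charpolyRev.coeff n =
      (-1) ^ n * ∑ s ∈ S.powersetCard n, (A.submatrix (Subtype.val : s → ι) Subtype.val).det := by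
  rw [coeff_charpolyRev_eq_sum_minors]
  conv_rhs => rw [← S.attach_map_val, powersetCard_map, sum_map, ← univ_eq_attach]
  refine congrArg _ (sum_congr rfl fun s _ => ?_)
  exact Matrix.det_submatrix_equiv_self (s.equivMap (Function.Embedding.subtype (· ∈ S)))
    (A.submatrix (Subtype.val : s.map (Function.Embedding.subtype (· ∈ S)) → ι) Subtype.val)

variable {K : Type*} [NormedField K] [IsUltrametricDist K]

theorem exists_isFredholmDet_of_tendsto [DecidableEq ι] [CompleteSpace K] (A : Matrix ι ι K)
    (h : Tendsto (fun s : Finset ι => (A.submatrix (Subtype.val : s → ι) Subtype.val).det)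
      cofinite (𝓝 0)) : ∃ P, IsFredholmDet A P := by
  let minor (n : ℕ) (s : Finset ι) : K :=
    if s.card = n then (A.submatrix (Subtype.val : s → ι) Subtype.val).det else 0
  have hsum : ∀ n, Summable (minor n) := fun n => by
    apply NonarchimedeanAddGroup.summable_of_tendsto_cofinite_zero
    rw [tendsto_zero_iff_norm_tendsto_zero] at h ⊢
    refine squeeze_zero (fun _ => norm_nonneg _) (fun s => ?_) h
    simp only [minor]
    split_ifs
    · exact le_rfl
    · simp
  have hpow : Tendsto (fun S : Finset ι => S.powerset) atTop atTop :=
    tendsto_atTop_finset_of_monotone (fun _ _ h => powerset_mono.2 h)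
      fun s => ⟨s, mem_powerset_self s⟩
  refine ⟨PowerSeries.mk fun n => (-1) ^ n * ∑' s, minor n s, fun n => ?_⟩
  rw [PowerSeries.coeff_mk]
  refine (((hsum n).hasSum.comp hpow).const_mul ((-1) ^ n)).congr fun S => ?_
  rw [coeff_charpolyRev_submatrix, Function.comp_apply, powersetCard_eq_filter, sum_filter]

theorem norm_det_le_of_row [Fintype ι] [DecidableEq ι] {M : Matrix ι ι K} {C : ℝ} (i : ι)
    (hone : ∀ i j, ‖M i j‖ ≤ 1) (hrow : ∀ j, ‖M i j‖ ≤ C) : ‖M.det‖ ≤ C := by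
  rw [← Matrix.det_transpose, Matrix.det_apply]
  refine IsUltrametricDist.norm_sum_le_of_forall_le_of_nonneg
    ((norm_nonneg _).trans (hrow i)) fun σ _ => ?_
  rw [Units.smul_def, zsmul_eq_mul, norm_mul, norm_prod, ← mul_prod_erase _ _ (mem_univ i)]
  calc _ ≤ ‖M i (σ i)‖ * ∏ k ∈ univ.erase i, ‖M k (σ k)‖ :=
        mul_le_of_le_one_left (by positivity) (IsUltrametricDist.norm_intCast_le_one K _)
    _ ≤ ‖M i (σ i)‖ := mul_le_of_le_one_right (norm_nonneg _)
        (prod_le_one (fun _ _ => norm_nonneg _) fun k _ => hone k (σ k))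
    _ ≤ C := hrow (σ i)

theorem exists_isFredholmDet_of_lowerTriangle [LinearOrder ι] [LocallyFiniteOrderBot ι]
    [CompleteSpace K] (A : Matrix ι ι K) (hone : ∀ i j, ‖A i j‖ ≤ 1)
    (hlower : ∀ ε > 0, ∃ m, ∀ i j, m ≤ i → j ≤ i → ‖A i j‖ ≤ ε) : ∃ P, IsFredholmDet A P := by
  refine exists_isFredholmDet_of_tendsto A (Metric.tendsto_nhds.2 fun ε hε => ?_)
  obtain ⟨m, hm⟩ := hlower (ε / 2) (half_pos hε)
  refine eventually_cofinite.2 ((Iio m).powerset.finite_toSet.subset fun s hs => ?_)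
  by_contra hnot
  obtain ⟨i, his, him⟩ := not_subset.1 fun h => hnot (mem_powerset.2 h)
  have hmi : m ≤ i := not_lt.1 fun h => him (mem_Iio.2 h)
  let top : s := ⟨s.max' ⟨i, his⟩, s.max'_mem _⟩
  have hrow : ∀ j : s, ‖A top j‖ ≤ ε / 2 := fun j =>
    hm _ _ (hmi.trans (s.le_max' i his)) (s.le_max' _ j.2)
  refine hs ?_
  rw [dist_zero_right]
  exact (norm_det_le_of_row (M := A.submatrix Subtype.val Subtype.val) top (fun _ _ => hone _ _)
    hrow).trans_lt (half_lt_self hε)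

theorem exists_isFredholmDet_A₁ [CharZero K] [CompleteSpace K] {p : ℕ} [Fact p.Prime] {ϖ : K}
    (hpK : ‖(p : K)‖ < 1) (hϖ : ϖ ^ (p - 1) = -(p : K)) {D : Finset ℕ} (hpos : ∀ d ∈ D, 0 < d)
    {a : D → K} (ha : ∀ d, ‖a d‖ ≤ 1) : ∃ P, IsFredholmDet (A₁ p ϖ D a) P := by
  apply exists_isFredholmDet_of_lowerTriangle
  · intro i j
    rw [A₁_apply]
    split_ifs
    · exact norm_coeff_F₁_le_one hpK hϖ hpos ha _
    · simp
  · intro ε hε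
    obtain ⟨M, hM⟩ := Metric.tendsto_atTop.1 (tendsto_coeff_F₁ hpK hϖ hpos ha) ε hε
    refine ⟨M.succPNat, fun i j hi hj => ?_⟩
    have hi' : M + 1 ≤ (i : ℕ) := by exact_mod_cast hi
    have hj' : (j : ℕ) ≤ i := by exact_mod_cast hj
    have htwo : 2 * (i : ℕ) ≤ p * i := Nat.mul_le_mul_right _ (Fact.out : p.Prime).two_le
    rw [A₁_apply]
    split_ifs
    · simpa only [dist_zero_right] using (hM (p * i - j) (by omega)).le
    · simpa using hε.le

end Fredholm

/-! ### Orbits of a permutation -/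

section Orbits

open Finset Function Equiv.Perm

variable {ι : Type*}

theorem minimalPeriod_perm_pos [Finite ι] (σ : Equiv.Perm ι) (i : ι) : 0 < minimalPeriod σ i :=
  minimalPeriod_pos_of_mem_periodicPts (σ.injective.mem_periodicPts i)

theorem exists_iterate_eq_of_iterate_eq [Finite ι] {σ : Equiv.Perm ι} {i j : ι} {k : ℕ}
    (h : σ^[k] i = j) : ∃ l, σ^[l] j = i := by
  refine ⟨minimalPeriod σ i * k - k, ?_⟩
  rw [← h, ← iterate_add_apply,
    Nat.sub_add_cancel (Nat.le_mul_of_pos_left _ (minimalPeriod_perm_pos σ i))]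
  exact (isPeriodicPt_minimalPeriod σ i).mul_const k

theorem sameCycle_iff_exists_iterate_eq [Finite ι] {σ : Equiv.Perm ι} {i j : ι} :
    σ.SameCycle i j ↔ ∃ k, σ^[k] i = j := by
  simp only [iterate_eq_pow]
  exact ⟨fun h => h.exists_nat_pow_eq, fun ⟨k, hk⟩ => ⟨k, by rwa [zpow_natCast]⟩⟩

theorem card_support_cycleOf [Fintype ι] [DecidableEq ι] {σ : Equiv.Perm ι} {i : ι}
    (hi : σ i ≠ i) : #(σ.cycleOf i).support = minimalPeriod σ i := by
  have horbit : (σ.cycleOf i).support = (range (minimalPeriod σ i)).image fun k => σ^[k] i := by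
    ext j
    rw [mem_support_cycleOf_iff' hi, sameCycle_iff_exists_iterate_eq, mem_image]
    refine ⟨fun ⟨k, hk⟩ => ⟨k % minimalPeriod σ i, ?_, ?_⟩, fun ⟨k, _, hk⟩ => ⟨k, hk⟩⟩
    · exact mem_range.2 (Nat.mod_lt _ (minimalPeriod_perm_pos σ i))
    · rw [iterate_mod_minimalPeriod_eq, hk]
  rw [horbit, card_image_of_injOn, card_range]
  rw [coe_range]
  exact iterate_injOn_Iio_minimalPeriod

variable [Fintype ι] {α : Type*} [LinearOrder α] {c : ι → α} {σ : Equiv.Perm ι}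

/-- The elements at which `c` is minimal on their orbit under `σ`: when `c` is injective, one
representative of each orbit. -/
noncomputable def orbitReps (c : ι → α) (σ : Equiv.Perm ι) : Finset ι :=
  open scoped Classical in {i | ∀ k, c i ≤ c (σ^[k] i)}

theorem mem_orbitReps {i : ι} : i ∈ orbitReps c σ ↔ ∀ k, c i ≤ c (σ^[k] i) := by
  simp [orbitReps]

theorem eq_of_mem_orbitReps (hc : Injective c) {i j : ι} (hi : i ∈ orbitReps c σ)
    (hj : j ∈ orbitReps c σ) {k l : ℕ} (h : σ^[k] i = σ^[l] j) : i = j := by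
  obtain ⟨m, hm⟩ := exists_iterate_eq_of_iterate_eq h
  obtain ⟨m', hm'⟩ := exists_iterate_eq_of_iterate_eq h.symm
  rw [← iterate_add_apply] at hm hm'
  exact hc (le_antisymm (hm' ▸ mem_orbitReps.1 hi _) (hm ▸ mem_orbitReps.1 hj _))

theorem exists_mem_orbitReps (c : ι → α) (σ : Equiv.Perm ι) (x : ι) :
    ∃ i ∈ orbitReps c σ, ∃ k < minimalPeriod σ i, σ^[k] i = x := by
  obtain ⟨_, ⟨m, rfl⟩, hm⟩ := Set.exists_min_image (Set.range fun k => σ^[k] x) c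
    (Set.toFinite _) (Set.range_nonempty _)
  obtain ⟨l, hl⟩ := exists_iterate_eq_of_iterate_eq (rfl : σ^[m] x = _)
  refine ⟨σ^[m] x, mem_orbitReps.2 fun k => hm _ ⟨k + m, iterate_add_apply _ _ _ _⟩,
    l % minimalPeriod σ (σ^[m] x), Nat.mod_lt _ (minimalPeriod_perm_pos _ _), ?_⟩
  rw [iterate_mod_minimalPeriod_eq, hl]

theorem bijOn_orbits (hc : Injective c) (σ : Equiv.Perm ι) :
    Set.BijOn (fun x : (_ : ι) × ℕ => σ^[x.2] x.1)
      ((orbitReps c σ).sigma fun i => range (minimalPeriod σ i)) (univ : Finset ι) := by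
  refine ⟨fun _ _ => mem_coe.2 (mem_univ _), ?_, ?_⟩
  · rintro ⟨i, k⟩ hx ⟨j, l⟩ hy h
    simp only [mem_coe, mem_sigma, mem_range] at hx hy h
    obtain rfl := eq_of_mem_orbitReps hc hx.1 hy.1 h
    rw [(iterate_eq_iterate_iff_of_lt_minimalPeriod hx.2 hy.2).1 h]
  · intro x _
    obtain ⟨i, hi, k, hk, rfl⟩ := exists_mem_orbitReps c σ x
    exact ⟨⟨i, k⟩, by simpa using ⟨hi, hk⟩, rfl⟩

@[to_additive]
theorem prod_orbits {M : Type*} [CommMonoid M] (hc : Injective c) (σ : Equiv.Perm ι) (F : ι → M) :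
    ∏ i, F i = ∏ i ∈ orbitReps c σ, ∏ k ∈ range (minimalPeriod σ i), F (σ^[k] i) := by
  have h := bijOn_orbits hc σ
  rw [prod_sigma']
  exact (prod_nbij _ h.mapsTo h.injOn h.surjOn fun _ _ => rfl).symm

theorem sum_minimalPeriod (hc : Injective c) (σ : Equiv.Perm ι) :
    ∑ i ∈ orbitReps c σ, minimalPeriod σ i = Fintype.card ι := by
  simpa using (sum_orbits (M := ℕ) hc σ fun _ => 1).symm

variable [DecidableEq ι]

theorem bijOn_cycleOf_orbitReps (hc : Injective c) (σ : Equiv.Perm ι) :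
    Set.BijOn σ.cycleOf ({i ∈ orbitReps c σ | σ i ≠ i} : Finset ι) σ.cycleFactorsFinset := by
  refine ⟨fun i hi => ?_, fun i hi j hj h => ?_, fun g hg => ?_⟩
  · rw [mem_coe, cycleOf_mem_cycleFactorsFinset_iff, Equiv.Perm.mem_support]
    exact (mem_filter.1 hi).2
  · rw [mem_coe, mem_filter] at hi hj
    obtain ⟨k, hk⟩ := sameCycle_iff_exists_iterate_eq.1 <|
      (sameCycle_iff_cycleOf_eq_of_mem_support (Equiv.Perm.mem_support.2 hi.2)
        (Equiv.Perm.mem_support.2 hj.2)).2 h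
    exact eq_of_mem_orbitReps (l := 0) hc hi.1 hj.1 hk
  · obtain ⟨x, hx⟩ := (mem_cycleFactorsFinset_iff.1 hg).1.nonempty_support
    obtain ⟨i, hi, k, -, hk⟩ := exists_mem_orbitReps c σ x
    have hsame : σ.SameCycle i x := sameCycle_iff_exists_iterate_eq.2 ⟨k, hk⟩
    have hmoved : i ∈ σ.support :=
      hsame.mem_support_iff.2 (mem_cycleFactorsFinset_support_le hg hx)
    exact ⟨i, mem_coe.2 (mem_filter.2 ⟨hi, Equiv.Perm.mem_support.1 hmoved⟩),
      hsame.cycleOf_eq.trans (cycle_is_cycleOf hx hg).symm⟩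

theorem sign_eq_prod_orbitReps (hc : Injective c) (σ : Equiv.Perm ι) :
    sign σ = ∏ i ∈ orbitReps c σ, (-1) ^ (minimalPeriod σ i - 1) := by
  have hcycles : sign σ = ∏ g ∈ σ.cycleFactorsFinset, -(-1 : ℤˣ) ^ #g.support := by
    rw [sign_of_cycleType', cycleType_def, Multiset.map_map]
    rfl
  have hbij := bijOn_cycleOf_orbitReps hc σ
  have hfixed : ∀ i ∈ ({i ∈ orbitReps c σ | ¬σ i ≠ i} : Finset ι),
      (-1 : ℤˣ) ^ (minimalPeriod σ i - 1) = 1 := fun i hi => by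
    rw [minimalPeriod_eq_one_iff_isFixedPt.2 (not_not.1 (mem_filter.1 hi).2), Nat.sub_self,
      pow_zero]
  rw [hcycles, ← prod_filter_mul_prod_filter_not (orbitReps c σ) fun i => σ i ≠ i,
    prod_eq_one hfixed, mul_one]
  refine (prod_nbij _ hbij.mapsTo hbij.injOn hbij.surjOn fun i hi => ?_).symm
  obtain ⟨m, hm⟩ := Nat.exists_eq_succ_of_ne_zero (minimalPeriod_perm_pos σ i).ne'
  rw [card_support_cycleOf (mem_filter.1 hi).2, hm, Nat.succ_sub_one, pow_succ, mul_neg_one,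
    neg_neg]

end Orbits

/-! ### Systems of exponents attached to a permutation -/

section Systems

open Finset Function

variable {ι : Type*} {D : Finset ℕ} {p : ℕ} {c : ι → ℕ} {σ τ : Equiv.Perm ι} {u v : ι → D → ℕ}

/-- The relations `∑ d u_{i,d} = p c_i - c_{σ i}`: the exponents `u` occur in the term of the
permutation `σ` in the expansion of the minor `det (f_{p c_i - c_j})_{i,j}`. -/
def IsClosedSystem (D : Finset ℕ) (p : ℕ) (c : ι → ℕ) (σ : Equiv.Perm ι) (u : ι → D → ℕ) : Prop :=
  ∀ i, dot D (u i) + c (σ i) = p * c i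

/-- A system of exponents is critical if its exponents are digits, and if its weight is the lower
bound `N (p - 1) δ` for the weight of closed systems of size `N`. -/
def IsCritical [Fintype ι] (D : Finset ℕ) (p : ℕ) (u : ι → D → ℕ) : Prop :=
  (∀ i d, u i d < p) ∧ ((∑ i, tupleWeight D p (u i) : ℕ) : ℝ) =
    Fintype.card ι * (((p : ℝ) - 1) * density D p)

/-- The pair `(n, U)` formed by the length `n` of the orbit of `i` under `σ`, and the tuple `U`
whose digits are the values of `u` along this orbit. -/
noncomputable def orbitDatum (D : Finset ℕ) (p : ℕ) (σ : Equiv.Perm ι) (u : ι → D → ℕ) (i : ι) :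
    ℕ × (D → ℕ) :=
  (minimalPeriod σ i, tupleHorner D p (fun k => u (σ^[k] i)) (minimalPeriod σ i))

theorem tupleWeight_orbitDatum (hp : 1 < p) (hu : ∀ i d, u i d < p) (i : ι) :
    tupleWeight D p (orbitDatum D p σ u i).2 =
      ∑ k ∈ range (minimalPeriod σ i), tupleWeight D p (u (σ^[k] i)) :=
  tupleWeight_tupleHorner hp (fun _ => hu _) _

namespace IsClosedSystem

theorem isCarrySeq (h : IsClosedSystem D p c σ u) (i : ι) :
    IsCarrySeq D p (fun k => u (σ^[k] i)) (fun k => c (σ^[k] i)) := fun k => by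
  simpa only [iterate_succ_apply'] using h (σ^[k] i)

section Finite

variable [Finite ι]

theorem mul_density_le_sum_orbit (h : IsClosedSystem D p c σ u) (hp : 1 < p)
    (hpos : ∀ i, 0 < c i) (i : ι) :
    (minimalPeriod σ i : ℝ) * (((p : ℝ) - 1) * density D p) ≤
      (∑ k ∈ range (minimalPeriod σ i), tupleWeight D p (u (σ^[k] i)) : ℕ) :=
  (h.isCarrySeq i).mul_density_le_sum hp (minimalPeriod_perm_pos σ i)
    (congrArg c iterate_minimalPeriod) (hpos _)

theorem phiSeq_orbitDatum (h : IsClosedSystem D p c σ u) (hp : 1 < p) (hu : ∀ i d, u i d < p)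
    (i : ι) (m : ℕ) :
    phiSeq D p (orbitDatum D p σ u i).1 (orbitDatum D p σ u i).2 m = c (σ^[m] i) :=
  (h.isCarrySeq i).phiSeq_tupleHorner hp (fun _ => hu _) (minimalPeriod_perm_pos σ i).ne'
    (fun _ => congrArg u iterate_add_minimalPeriod_eq)
    (fun _ => congrArg c iterate_add_minimalPeriod_eq) m

theorem mem_support_orbitDatum (h : IsClosedSystem D p c σ u) (hp : 1 < p)
    (hu : ∀ i d, u i d < p) {i : ι} {a : ℕ} :
    a ∈ support D p (orbitDatum D p σ u i).1 (orbitDatum D p σ u i).2 ↔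
      ∃ k, c (σ^[k] i) = a := by
  simp only [support, mem_image, h.phiSeq_orbitDatum hp hu]
  refine ⟨fun ⟨k, _, hk⟩ => ⟨k, hk⟩, fun ⟨k, hk⟩ => ⟨k % minimalPeriod σ i, ?_, ?_⟩⟩
  · exact mem_range.2 (Nat.mod_lt _ (minimalPeriod_perm_pos σ i))
  · rw [iterate_mod_minimalPeriod_eq, hk]

theorem card_support_orbitDatum (h : IsClosedSystem D p c σ u) (hp : 1 < p) (hc : Injective c)
    (hu : ∀ i d, u i d < p) (i : ι) :
    #(support D p (orbitDatum D p σ u i).1 (orbitDatum D p σ u i).2) = minimalPeriod σ i := by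
  rw [support, card_image_of_injOn, card_range]
  · rfl
  · intro k hk l hl hkl
    rw [h.phiSeq_orbitDatum hp hu, h.phiSeq_orbitDatum hp hu] at hkl
    exact iterate_injOn_Iio_minimalPeriod (mem_range.1 hk) (mem_range.1 hl) (hc hkl)

theorem orbitDatum_mem_E (h : IsClosedSystem D p c σ u) (hp : 1 < p) (hpos : ∀ i, 0 < c i)
    (hu : ∀ i d, u i d < p) (i : ι) :
    (orbitDatum D p σ u i).2 ∈ E D p (orbitDatum D p σ u i).1 := by
  have hq := Nat.one_lt_pow (minimalPeriod_perm_pos σ i).ne' hp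
  have hdot := (h.isCarrySeq i).dot_tupleHorner (congrArg c iterate_minimalPeriod)
  refine ⟨fun d => Nat.le_sub_one_of_lt (horner_lt (fun k => hu _ d) _), Dvd.intro _ hdot.symm, ?_⟩
  exact hdot ▸ Nat.mul_pos (Nat.sub_pos_of_lt hq) (hpos _)

theorem orbitDatum_injective (h : IsClosedSystem D p c σ u) (hp : 1 < p) (hc : Injective c)
    (hu : ∀ i d, u i d < p) : Injective (orbitDatum D p σ u) := fun i j hij => by
  have hi := h.phiSeq_orbitDatum hp hu i 0
  rw [hij, h.phiSeq_orbitDatum hp hu j 0] at hi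
  exact hc hi.symm

end Finite

variable [Fintype ι]

theorem card_mul_density_le (h : IsClosedSystem D p c σ u) (hp : 1 < p) (hc : Injective c)
    (hpos : ∀ i, 0 < c i) :
    (Fintype.card ι : ℝ) * (((p : ℝ) - 1) * density D p) ≤
      (∑ i, tupleWeight D p (u i) : ℕ) := by
  rw [sum_orbits hc σ, ← sum_minimalPeriod hc σ, Nat.cast_sum, Nat.cast_sum, sum_mul]
  exact sum_le_sum fun i _ => h.mul_density_le_sum_orbit hp hpos i

theorem sum_orbit_eq (h : IsClosedSystem D p c σ u) (hp : 1 < p) (hc : Injective c)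
    (hpos : ∀ i, 0 < c i) (hu : IsCritical D p u) {i : ι} (hi : i ∈ orbitReps c σ) :
    ((∑ k ∈ range (minimalPeriod σ i), tupleWeight D p (u (σ^[k] i)) : ℕ) : ℝ) =
      minimalPeriod σ i * (((p : ℝ) - 1) * density D p) := by
  have htotal := hu.2
  rw [sum_orbits hc σ, ← sum_minimalPeriod hc σ, Nat.cast_sum, Nat.cast_sum, sum_mul] at htotal
  exact ((sum_eq_sum_iff_of_le fun i _ => h.mul_density_le_sum_orbit hp hpos i).1 htotal.symm
    i hi).symm

theorem orbitDatum_mem_MIStar (h : IsClosedSystem D p c σ u) (hp : 1 < p) (hc : Injective c)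
    (hpos : ∀ i, 0 < c i) (hu : IsCritical D p u) {i : ι} (hi : i ∈ orbitReps c σ) :
    orbitDatum D p σ u i ∈ MIStar D p := by
  refine ⟨⟨h.orbitDatum_mem_E hp hpos hu.1 i, ?_, h.card_support_orbitDatum hp hc hu.1 i⟩, ?_⟩
  · refine (tupleDensity_eq_density_iff hp (minimalPeriod_perm_pos σ i).ne').2 ?_
    rw [tupleWeight_orbitDatum hp hu.1, h.sum_orbit_eq hp hc hpos hu hi]
  · intro a ha
    obtain ⟨k, rfl⟩ := (h.mem_support_orbitDatum hp hu.1).1 ha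
    rw [h.phiSeq_orbitDatum hp hu.1]
    exact mem_orbitReps.1 hi k

theorem range_subset_sigmaSet (h : IsClosedSystem D p c σ u) (hp : 1 < p) (hc : Injective c)
    (hpos : ∀ i, 0 < c i) (hu : IsCritical D p u) : Set.range c ⊆ sigmaSet D p := by
  rintro _ ⟨x, rfl⟩
  obtain ⟨i, hi, k, -, rfl⟩ := exists_mem_orbitReps c σ x
  exact Set.mem_biUnion (h.orbitDatum_mem_MIStar hp hc hpos hu hi).1
    ((h.mem_support_orbitDatum hp hu.1).2 ⟨k, rfl⟩)

end IsClosedSystem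

theorem isCritical_of_forall_mem_MIAll [Fintype ι] (hp : 1 < p) (hc : Injective c)
    (hu : ∀ i d, u i d < p) (h : ∀ i ∈ orbitReps c σ, orbitDatum D p σ u i ∈ MIAll D p) :
    IsCritical D p u := by
  refine ⟨hu, ?_⟩
  rw [sum_orbits hc σ, ← sum_minimalPeriod hc σ, Nat.cast_sum, Nat.cast_sum, sum_mul]
  refine sum_congr rfl fun i hi => ?_
  rw [← tupleWeight_orbitDatum hp hu]
  exact (tupleDensity_eq_density_iff hp (minimalPeriod_perm_pos σ i).ne').1 (h i hi).2.1

/-! ### Critical systems and partitions into supports -/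

variable [Fintype ι]

/-- The set of the tuples attached to the orbits of `σ`. -/
noncomputable def orbitData (D : Finset ℕ) (p : ℕ) (c : ι → ℕ) (σ : Equiv.Perm ι)
    (u : ι → D → ℕ) : Finset (ℕ × (D → ℕ)) :=
  (orbitReps c σ).image (orbitDatum D p σ u)

theorem mem_orbitData {x : ℕ × (D → ℕ)} :
    x ∈ orbitData D p c σ u ↔ ∃ i ∈ orbitReps c σ, orbitDatum D p σ u i = x :=
  mem_image

namespace IsClosedSystem

theorem pairwiseDisjoint_support_orbitData (h : IsClosedSystem D p c σ u) (hp : 1 < p)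
    (hc : Injective c) (hu : ∀ i d, u i d < p) :
    (orbitData D p c σ u : Set (ℕ × (D → ℕ))).PairwiseDisjoint fun x => support D p x.1 x.2 := by
  intro x hx y hy hxy
  obtain ⟨i, hi, rfl⟩ := mem_orbitData.1 (mem_coe.1 hx)
  obtain ⟨j, hj, rfl⟩ := mem_orbitData.1 (mem_coe.1 hy)
  refine disjoint_left.2 fun a ha hb => hxy ?_
  obtain ⟨k, hk⟩ := (h.mem_support_orbitDatum hp hu).1 ha
  obtain ⟨l, hl⟩ := (h.mem_support_orbitDatum hp hu).1 hb
  rw [eq_of_mem_orbitReps hc hi hj (hc (hk.trans hl.symm))]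

theorem biUnion_support_orbitData (h : IsClosedSystem D p c σ u) (hp : 1 < p)
    (hu : ∀ i d, u i d < p) :
    (⋃ x ∈ orbitData D p c σ u, (support D p x.1 x.2 : Set ℕ)) = Set.range c := by
  refine subset_antisymm (Set.iUnion₂_subset fun x hx a ha => ?_) ?_
  · obtain ⟨i, -, rfl⟩ := mem_orbitData.1 hx
    obtain ⟨k, rfl⟩ := (h.mem_support_orbitDatum hp hu).1 ha
    exact Set.mem_range_self _
  · rintro _ ⟨x, rfl⟩
    obtain ⟨i, hi, k, -, rfl⟩ := exists_mem_orbitReps c σ x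
    exact Set.mem_biUnion (mem_orbitData.2 ⟨i, hi, rfl⟩)
      ((h.mem_support_orbitDatum hp hu).2 ⟨k, rfl⟩)

theorem orbitData_mem_partitions (h : IsClosedSystem D p c σ u) (hp : 1 < p) (hc : Injective c)
    (hpos : ∀ i, 0 < c i) (hrange : Set.range c = sigmaSet D p) (hu : IsCritical D p u) :
    orbitData D p c σ u ∈ partitions D p := by
  refine ⟨fun x hx => ?_, h.pairwiseDisjoint_support_orbitData hp hc hu.1,
    (h.biUnion_support_orbitData hp hu.1).trans hrange⟩
  obtain ⟨i, hi, rfl⟩ := mem_orbitData.1 (mem_coe.1 hx)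
  exact h.orbitDatum_mem_MIStar hp hc hpos hu hi

theorem eq_of_orbitData_eq (h : IsClosedSystem D p c σ u) (h' : IsClosedSystem D p c τ v)
    (hp : 1 < p) (hc : Injective c) (hu : ∀ i d, u i d < p) (hv : ∀ i d, v i d < p)
    (heq : orbitData D p c σ u = orbitData D p c τ v) : σ = τ ∧ u = v := by
  have hpointwise : ∀ x, σ x = τ x ∧ u x = v x := fun x => by
    obtain ⟨i, hi, k, hk, rfl⟩ := exists_mem_orbitReps c σ x
    obtain ⟨j, -, hj⟩ := mem_orbitData.1 (heq ▸ mem_orbitData.2 ⟨i, hi, rfl⟩)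
    have hphi : ∀ m, c (τ^[m] j) = c (σ^[m] i) := fun m => by
      rw [← h.phiSeq_orbitDatum hp hu, ← h'.phiSeq_orbitDatum hp hv, hj]
    obtain rfl : j = i := hc (hphi 0)
    have hiter : ∀ m, τ^[m] j = σ^[m] j := fun m => hc (hphi m)
    have hperiod : minimalPeriod τ j = minimalPeriod σ j := congrArg Prod.fst hj
    have htuple := congrArg Prod.snd hj
    simp only [orbitDatum, hperiod] at htuple
    constructor
    · rw [← iterate_succ_apply' σ, ← hiter, ← hiter, ← iterate_succ_apply' τ]
    · funext d
      rw [← eq_of_horner_eq (fun m => hv (τ^[m] j) d) (fun m => hu (σ^[m] j) d)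
        (congrFun htuple d) k hk, hiter]
  exact ⟨Equiv.ext fun x => (hpointwise x).1, funext fun x => (hpointwise x).2⟩

end IsClosedSystem

end Systems

/-! ### The critical system of a partition -/

section Partitions

open Finset Function

variable {D : Finset ℕ} {p : ℕ} {𝒰 : Finset (ℕ × (D → ℕ))} {x y : ℕ × (D → ℕ)}

theorem mem_MI_of_mem_partition (h𝒰 : 𝒰 ∈ partitions D p) (hx : x ∈ 𝒰) : x.2 ∈ MI D p x.1 :=
  (h𝒰.1 (mem_coe.2 hx)).1

theorem mem_sigmaSet_iff_exists_phiSeq (hp : 0 < p) (h𝒰 : 𝒰 ∈ partitions D p) {a : ℕ} :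
    a ∈ sigmaSet D p ↔ ∃ x ∈ 𝒰, ∃ k, phiSeq D p x.1 x.2 k = a := by
  simp only [← h𝒰.2.2, Set.mem_iUnion, mem_coe, exists_prop]
  exact exists_congr fun x => and_congr_right fun hx =>
    mem_support_iff hp (mem_MI_of_mem_partition h𝒰 hx).1

theorem eq_of_phiSeq_eq (hp : 0 < p) (h𝒰 : 𝒰 ∈ partitions D p) (hx : x ∈ 𝒰) (hy : y ∈ 𝒰)
    {k l : ℕ} (h : phiSeq D p x.1 x.2 k = phiSeq D p y.1 y.2 l) : x = y := by
  by_contra hxy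
  exact disjoint_left.1 (h𝒰.2.1 (mem_coe.2 hx) (mem_coe.2 hy) hxy)
    ((mem_support_iff hp (mem_MI_of_mem_partition h𝒰 hx).1).2 ⟨k, h⟩)
    ((mem_support_iff hp (mem_MI_of_mem_partition h𝒰 hy).1).2 ⟨l, rfl⟩)

variable {ι : Type*} {c : ι → ℕ} {σ : Equiv.Perm ι} {u : ι → D → ℕ}

/-- `σ` and `u` follow the tuple `U = x.2` if, at each index `i` with `c_i = φ_U(m)`, the exponents
`u_i` are the digits of index `m` of `U`, and `c_{σ i} = φ_U(m + 1)`. -/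
def Follows (c : ι → ℕ) (σ : Equiv.Perm ι) (u : ι → D → ℕ) (p : ℕ) (x : ℕ × (D → ℕ)) : Prop :=
  ∀ ⦃i m⦄, c i = phiSeq D p x.1 x.2 m →
    u i = tupleDigits D p x.1 x.2 m ∧ c (σ i) = phiSeq D p x.1 x.2 (m + 1)

theorem exists_follows [Finite ι] (hp : 0 < p) (hc : Injective c)
    (hrange : Set.range c = sigmaSet D p) (h𝒰 : 𝒰 ∈ partitions D p) :
    ∃ (σ : Equiv.Perm ι) (u : ι → D → ℕ), ∀ x ∈ 𝒰, Follows c σ u p x := by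
  have hmem (a : ℕ) : a ∈ Set.range c ↔ ∃ x ∈ 𝒰, ∃ k, phiSeq D p x.1 x.2 k = a :=
    hrange ▸ mem_sigmaSet_iff_exists_phiSeq hp h𝒰
  have hposition (i : ι) : ∃ x ∈ 𝒰, ∃ k, phiSeq D p x.1 x.2 k = c i :=
    (hmem _).1 (Set.mem_range_self i)
  have hindex : ∀ x ∈ 𝒰, ∀ k, ∃ i, c i = phiSeq D p x.1 x.2 k := fun x hx k =>
    (hmem _).2 ⟨x, hx, k, rfl⟩
  choose X hX κ hκ using hposition
  choose s hs using fun i => hindex (X i) (hX i) (κ i + 1)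
  have hMI := fun i => mem_MI_of_mem_partition h𝒰 (hX i)
  have hfollows : ∀ x ∈ 𝒰, ∀ ⦃i m⦄, c i = phiSeq D p x.1 x.2 m →
      tupleDigits D p (X i).1 (X i).2 (κ i) = tupleDigits D p x.1 x.2 m ∧
        c (s i) = phiSeq D p x.1 x.2 (m + 1) := by
    intro x hx i m hi
    obtain rfl := eq_of_phiSeq_eq hp h𝒰 (hX i) hx ((hκ i).trans hi)
    have hmod := modEq_of_phiSeq_eq hp (hMI i) ((hκ i).trans hi)
    exact ⟨eq_of_periodic_of_modEq (periodic_tupleDigits _ _) hmod,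
      (hs i).trans (eq_of_periodic_of_modEq (periodic_phiSeq hp (hMI i).1) (hmod.add_right 1))⟩
  have hsurj : Surjective s := fun j => by
    have hn := pos_of_mem_E (hMI j).1
    obtain ⟨i, hi⟩ := hindex (X j) (hX j) (κ j + ((X j).1 - 1))
    refine ⟨i, hc ?_⟩
    rw [(hfollows _ (hX j) hi).2, add_assoc, Nat.sub_add_cancel hn,
      periodic_phiSeq hp (hMI j).1, hκ]
  exact ⟨.ofBijective s (Finite.surjective_iff_bijective.1 hsurj), _, hfollows⟩

theorem isClosedSystem_of_follows (hp : 1 < p) (h𝒰 : 𝒰 ∈ partitions D p)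
    (hrange : Set.range c ⊆ sigmaSet D p) (h : ∀ x ∈ 𝒰, Follows c σ u p x) :
    IsClosedSystem D p c σ u ∧ ∀ i d, u i d < p := by
  refine forall_and.1 fun i => ?_
  obtain ⟨x, hx, m, hm⟩ :=
    (mem_sigmaSet_iff_exists_phiSeq (by omega) h𝒰).1 (hrange (Set.mem_range_self i))
  obtain ⟨hdigits, hnext⟩ := h x hx hm.symm
  rw [hdigits, hnext, ← hm]
  exact ⟨isCarrySeq_phiSeq hp (mem_MI_of_mem_partition h𝒰 hx).1 m,
    tupleDigits_lt (by omega) _ _⟩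

namespace Follows

theorem iterate (h : Follows c σ u p x) {i : ι} {m : ℕ} (hi : c i = phiSeq D p x.1 x.2 m) (k : ℕ) :
    c (σ^[k] i) = phiSeq D p x.1 x.2 (m + k) := by
  induction k with
  | zero => exact hi
  | succ k ih =>
    rw [iterate_succ_apply']
    exact (h ih).2

theorem minimalPeriod_eq (h : Follows c σ u p x) (hp : 0 < p) (hc : Injective c)
    (hx : x.2 ∈ MI D p x.1) {i : ι} (hi : c i = phiSeq D p x.1 x.2 0) :
    minimalPeriod σ i = x.1 := by
  refine Nat.dvd_antisymm (IsPeriodicPt.minimalPeriod_dvd (hc ?_)) ?_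
  · rw [h.iterate hi, periodic_phiSeq hp hx.1, hi]
  · have hreturn := h.iterate hi (minimalPeriod σ i)
    rw [iterate_minimalPeriod, hi, zero_add] at hreturn
    exact (Nat.modEq_zero_iff_dvd).1 (modEq_of_phiSeq_eq hp hx hreturn.symm)

theorem orbitDatum_eq (h : Follows c σ u p x) (hp : 0 < p) (hc : Injective c)
    (hx : x.2 ∈ MI D p x.1) {i : ι} (hi : c i = phiSeq D p x.1 x.2 0) :
    orbitDatum D p σ u i = x := by
  have hdigits : (fun k => u (σ^[k] i)) = tupleDigits D p x.1 x.2 := by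
    funext k
    rw [(h (h.iterate hi k)).1, zero_add]
  rw [orbitDatum, h.minimalPeriod_eq hp hc hx hi, hdigits, tupleHorner_tupleDigits hp hx.1.1]

theorem mem_orbitReps [Fintype ι] (h : Follows c σ u p x) (hp : 0 < p) (hx : x ∈ MIStar D p)
    {i : ι} (hi : c i = phiSeq D p x.1 x.2 0) : i ∈ orbitReps c σ :=
  DworkHasse.mem_orbitReps.2 fun k => by
    rw [h.iterate hi, hi]
    exact hx.2 _ ((mem_support_iff hp hx.1.1).2 ⟨_, rfl⟩)

end Follows

theorem orbitData_eq_of_follows [Fintype ι] (hp : 0 < p) (hc : Injective c)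
    (hrange : Set.range c = sigmaSet D p) (h𝒰 : 𝒰 ∈ partitions D p)
    (h : ∀ x ∈ 𝒰, Follows c σ u p x) : orbitData D p c σ u = 𝒰 := by
  have hstart : ∀ x ∈ 𝒰, ∃ i ∈ orbitReps c σ, c i = phiSeq D p x.1 x.2 0 ∧
      orbitDatum D p σ u i = x := fun x hx => by
    obtain ⟨i, hi⟩ : phiSeq D p x.1 x.2 0 ∈ Set.range c :=
      hrange ▸ (mem_sigmaSet_iff_exists_phiSeq hp h𝒰).2 ⟨x, hx, 0, rfl⟩
    exact ⟨i, (h x hx).mem_orbitReps hp (h𝒰.1 (mem_coe.2 hx)) hi, hi,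
      (h x hx).orbitDatum_eq hp hc (mem_MI_of_mem_partition h𝒰 hx) hi⟩
  ext x
  rw [mem_orbitData]
  constructor
  · rintro ⟨i, hi, rfl⟩
    obtain ⟨y, hy, k, hk⟩ :=
      (mem_sigmaSet_iff_exists_phiSeq hp h𝒰).1 (hrange ▸ Set.mem_range_self i)
    obtain ⟨j, hj, hstart, hdatum⟩ := hstart y hy
    have hreach : σ^[k] j = σ^[0] i := hc (by
      rw [(h y hy).iterate hstart, zero_add, hk, iterate_zero_apply])
    rwa [← eq_of_mem_orbitReps hc hj hi hreach, hdatum]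
  · intro hx
    obtain ⟨i, hi, -, hdatum⟩ := hstart x hx
    exact ⟨i, hi, hdatum⟩

theorem exists_isCritical_orbitData_eq [Fintype ι] (hp : 1 < p) (hc : Injective c)
    (hrange : Set.range c = sigmaSet D p) (h𝒰 : 𝒰 ∈ partitions D p) :
    ∃ (σ : Equiv.Perm ι) (u : ι → D → ℕ), IsClosedSystem D p c σ u ∧ IsCritical D p u ∧
      orbitData D p c σ u = 𝒰 := by
  obtain ⟨σ, u, h⟩ := exists_follows (by omega) hc hrange h𝒰
  obtain ⟨hsystem, hu⟩ := isClosedSystem_of_follows hp h𝒰 hrange.subset h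
  have hdata := orbitData_eq_of_follows (by omega) hc hrange h𝒰 h
  refine ⟨σ, u, hsystem, ?_, hdata⟩
  exact isCritical_of_forall_mem_MIAll hp hc hu fun i hi =>
    mem_MI_of_mem_partition h𝒰 (hdata ▸ mem_orbitData.2 ⟨i, hi, rfl⟩)

end Partitions

/-! ### The terms of the Hasse polynomial -/

section HasseTerm

open Finset Function

variable {ι : Type*} {D : Finset ℕ} {p : ℕ} {c : ι → ℕ} {σ : Equiv.Perm ι} {u : ι → D → ℕ}
  {K : Type*} [Field K] [CharZero K]

theorem aeval_hasseTerm_orbitDatum (hp : 1 < p) (hu : ∀ i d, u i d < p) (a : D → K) (i : ι) :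
    MvPolynomial.aeval a (hasseTerm D p (orbitDatum D p σ u i).2) =
      ∏ k ∈ range (minimalPeriod σ i),
        ∏ d : D, (a d ^ u (σ^[k] i) d / ((u (σ^[k] i) d).factorial : K)) := by
  rw [prod_comm, hasseTerm, map_mul, MvPolynomial.aeval_C, map_inv₀, map_prod, map_prod,
    ← prod_inv_distrib, ← prod_mul_distrib]
  refine prod_congr rfl fun d _ => ?_
  simp only [orbitDatum, tupleHorner]
  rw [weight_horner hp fun k => hu _ d, digitFactorial_horner hp fun k => hu _ d]
  simp [div_eq_mul_inv, prod_mul_distrib, prod_pow_eq_pow_sum, mul_comm]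

theorem IsClosedSystem.sign_mul_prod_eq_aeval [Fintype ι] [DecidableEq ι]
    (h : IsClosedSystem D p c σ u) (hp : 1 < p) (hc : Injective c) (hu : ∀ i d, u i d < p)
    (a : D → K) :
    (Equiv.Perm.sign σ : K) * ∏ i, ∏ d : D, (a d ^ u i d / ((u i d).factorial : K)) =
      MvPolynomial.aeval a ((-1) ^ (∑ x ∈ orbitData D p c σ u, (x.1 - 1)) *
        ∏ x ∈ orbitData D p c σ u, hasseTerm D p x.2) := by
  have hinj := (h.orbitDatum_injective hp hc hu).injOn (s := (orbitReps c σ : Set ι))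
  rw [sign_eq_prod_orbitReps hc σ, prod_orbits hc σ, orbitData, sum_image hinj, prod_image hinj,
    map_mul, map_prod, map_pow, map_neg, map_one, ← prod_pow_eq_pow_sum]
  congr 1
  · simp [orbitDatum]
  · exact prod_congr rfl fun i _ => (aeval_hasseTerm_orbitDatum hp hu a i).symm

end HasseTerm

/-! ### Expansion of the principal minors -/

section Minors

open Finset Filter Function

variable {K : Type*} [NormedField K] [CharZero K] {p : ℕ} {ϖ : K} {D : Finset ℕ} {a : D → K}

theorem A₁_apply_eq_sum (ϖ : K) (hpos : ∀ d ∈ D, 0 < d) (a : D → K) {i j : ℕ+} {B : ℕ}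
    (hB : p * i < B) :
    A₁ p ϖ D a i j = ∑ u ∈ (Fintype.piFinset fun _ : D => range B) with dot D u + j = p * i,
      ∏ d : D, (a d ^ u d * PowerSeries.coeff (u d) (theta p ϖ)) := by
  rw [A₁_apply]
  split_ifs with h
  · rw [coeff_F₁ ϖ hpos a ((Nat.sub_le _ _).trans_lt hB)]
    exact sum_congr (filter_congr fun u _ => by omega) fun _ _ => rfl
  · rw [filter_eq_empty_iff.2 fun u _ => by omega, sum_empty]

variable {ι : Type*} [Fintype ι] {c : ι → ℕ+}

/-- The integral part of `n (p - 1) δ`, which bounds from below the order in `ϖ` of the minors of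
`A_1` of size `n`. -/
noncomputable def minorOrder (D : Finset ℕ) (p n : ℕ) : ℕ :=
  ⌊(n : ℝ) * ((p : ℝ) - 1) * density D p⌋₊

theorem IsClosedSystem.minorOrder_le {σ : Equiv.Perm ι} {u : ι → D → ℕ}
    (h : IsClosedSystem D p (fun i => c i) σ u) (hp : 1 < p) (hc : Injective c) :
    minorOrder D p (Fintype.card ι) ≤ ∑ i, tupleWeight D p (u i) := by
  have hle := Nat.floor_mono <|
    h.card_mul_density_le hp (PNat.coe_injective.comp hc) fun i => (c i).pos
  rwa [← mul_assoc, Nat.floor_natCast] at hle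

theorem IsClosedSystem.isCritical_of_sum_eq_minorOrder {σ : Equiv.Perm ι} {u : ι → D → ℕ}
    (h : IsClosedSystem D p (fun i => c i) σ u) (hp : 1 < p) (hc : Injective c)
    (hu : ∀ i d, u i d < p)
    (hweight : ∑ i, tupleWeight D p (u i) = minorOrder D p (Fintype.card ι)) :
    IsCritical D p u := by
  have hp' : (0 : ℝ) ≤ (p : ℝ) - 1 := by
    rw [sub_nonneg]
    exact_mod_cast hp.le
  refine ⟨hu, le_antisymm ?_
    (h.card_mul_density_le hp (PNat.coe_injective.comp hc) fun i => (c i).pos)⟩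
  rw [hweight, ← mul_assoc]
  exact Nat.floor_le (mul_nonneg (mul_nonneg (Nat.cast_nonneg _) hp') (density_nonneg D hp))

variable [DecidableEq ι] {B : ℕ} {x : Equiv.Perm ι × (ι → D → ℕ)}

open scoped Classical in
/-- The pairs of a permutation `σ` and a system `u` of exponents less than `B` that occur in the
expansion of the minor `det (f_{p c_i - c_j})_{i,j}`. -/
noncomputable def closedSystems (D : Finset ℕ) (p B : ℕ) (c : ι → ℕ+) :
    Finset (Equiv.Perm ι × (ι → D → ℕ)) :=
  {x ∈ univ ×ˢ Fintype.piFinset fun _ => Fintype.piFinset fun _ => range B |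
    IsClosedSystem D p (fun i => c i) x.1 x.2}

theorem mem_closedSystems :
    x ∈ closedSystems D p B c ↔
      (∀ i d, x.2 i d < B) ∧ IsClosedSystem D p (fun i => c i) x.1 x.2 := by
  simp [closedSystems]

/-- The term attached to the permutation `x.1` and the exponents `x.2` in the expansion of a
principal minor of `A_1`. -/
noncomputable def minorTerm (p : ℕ) (ϖ : K) (D : Finset ℕ) (a : D → K)
    (x : Equiv.Perm ι × (ι → D → ℕ)) : K :=
  (Equiv.Perm.sign x.1 : K) *
    ∏ i, ∏ d : D, (a d ^ x.2 i d * PowerSeries.coeff (x.2 i d) (theta p ϖ))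

theorem det_submatrix_A₁ (ϖ : K) (hpos : ∀ d ∈ D, 0 < d) (a : D → K) (hB : ∀ i, p * c i < B) :
    ((A₁ p ϖ D a).submatrix c c).det = ∑ x ∈ closedSystems D p B c, minorTerm p ϖ D a x := by
  classical
  rw [closedSystems, sum_filter, sum_product, ← Matrix.det_transpose, Matrix.det_apply']
  refine sum_congr rfl fun σ _ => ?_
  have hentry : ∀ i, ((A₁ p ϖ D a).submatrix c c).transpose (σ i) i = _ := fun i =>
    A₁_apply_eq_sum ϖ hpos a (hB i)
  rw [← sum_filter, prod_congr rfl fun i _ => hentry i, prod_univ_sum, mul_sum]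
  refine sum_congr (Finset.ext fun u => ?_) fun u _ => rfl
  rw [mem_filter, Fintype.mem_piFinset, Fintype.mem_piFinset]
  simp only [mem_filter, IsClosedSystem, forall_and]

theorem minorTerm_of_isCritical [Fact p.Prime] (hϖ : ϖ ^ (p - 1) = -(p : K)) (a : D → K)
    (hx : IsCritical D p x.2) :
    minorTerm p ϖ D a x =
      (Equiv.Perm.sign x.1 : K) * (∏ i, ∏ d : D, (a d ^ x.2 i d / ((x.2 i d).factorial : K))) *
        ϖ ^ minorOrder D p (Fintype.card ι) := by
  have hp := (Fact.out : p.Prime).one_lt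
  have horder : minorOrder D p (Fintype.card ι) = ∑ i, ∑ d : D, x.2 i d := by
    rw [minorOrder, mul_assoc, ← hx.2, Nat.floor_natCast]
    exact sum_congr rfl fun i _ => sum_congr rfl fun d _ => weight_of_lt hp (hx.1 i d)
  rw [minorTerm, horder, mul_assoc]
  congr 1
  simp only [← prod_pow_eq_pow_sum, ← prod_mul_distrib]
  refine prod_congr rfl fun i _ => prod_congr rfl fun d _ => ?_
  rw [coeff_theta_of_lt hϖ (hx.1 i d)]
  ring

theorem sum_isCritical_eq_aeval_hassePoly [Fact p.Prime] (hB : p ≤ B) (hc : Injective c)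
    (hrange : Set.range (fun i => (c i : ℕ)) = sigmaSet D p) (a : D → K)
    [DecidablePred fun x : Equiv.Perm ι × (ι → D → ℕ) => IsCritical D p x.2] :
    ∑ x ∈ closedSystems D p B c with IsCritical D p x.2,
        (Equiv.Perm.sign x.1 : K) * (∏ i, ∏ d : D, (a d ^ x.2 i d / ((x.2 i d).factorial : K))) =
      MvPolynomial.aeval a (hassePoly D p) := by
  have hp := (Fact.out : p.Prime).one_lt
  have hc' : Injective fun i => (c i : ℕ) := PNat.coe_injective.comp hc
  rw [hassePoly, finsum_mem_eq_finite_toFinset_sum _ (partitions_finite D p), map_sum]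
  refine sum_nbij (fun x => orbitData D p (fun i => c i) x.1 x.2) (fun x hx => ?_)
    (fun x hx y hy hxy => ?_) (fun 𝒰 h𝒰 => ?_) fun x hx => ?_
  · obtain ⟨hmem, hcrit⟩ := mem_filter.1 hx
    exact (Set.Finite.mem_toFinset _).2 <| (mem_closedSystems.1 hmem).2.orbitData_mem_partitions hp
      hc' (fun i => (c i).pos) hrange hcrit
  · obtain ⟨hmem, hcrit⟩ := mem_filter.1 (mem_coe.1 hx)
    obtain ⟨hmem', hcrit'⟩ := mem_filter.1 (mem_coe.1 hy)
    exact Prod.ext_iff.2 <| (mem_closedSystems.1 hmem).2.eq_of_orbitData_eq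
      (mem_closedSystems.1 hmem').2 hp hc' hcrit.1 hcrit'.1 hxy
  · obtain ⟨σ, u, h, hu, rfl⟩ :=
      exists_isCritical_orbitData_eq hp hc' hrange ((Set.Finite.mem_toFinset _).1 h𝒰)
    exact ⟨(σ, u), mem_coe.2 <| mem_filter.2
      ⟨mem_closedSystems.2 ⟨fun i d => (hu.1 i d).trans_le hB, h⟩, hu⟩, rfl⟩
  · obtain ⟨hmem, hcrit⟩ := mem_filter.1 hx
    exact (mem_closedSystems.1 hmem).2.sign_mul_prod_eq_aeval hp hc' hcrit.1 a

section Norms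

variable [IsUltrametricDist K] [Fact p.Prime]

theorem norm_minorTerm_le (hpK : ‖(p : K)‖ < 1) (hϖ : ϖ ^ (p - 1) = -(p : K))
    (ha : ∀ d, ‖a d‖ ≤ 1) (x : Equiv.Perm ι × (ι → D → ℕ)) :
    ‖minorTerm p ϖ D a x‖ ≤ ‖ϖ‖ ^ (∑ i, (tupleWeight D p (x.2 i) + #{d | p ≤ x.2 i d})) := by
  have hfactor : ∀ i d, ‖a d ^ x.2 i d * PowerSeries.coeff (x.2 i d) (theta p ϖ)‖ ≤
      ‖ϖ‖ ^ (weight p (x.2 i d) + if p ≤ x.2 i d then 1 else 0) := fun i d => by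
    refine (norm_pow_mul_le (ha d) _).trans ?_
    split_ifs with h
    · exact norm_coeff_theta_le_of_le hpK hϖ h
    · exact norm_coeff_theta_le hpK hϖ _
  simp only [tupleWeight, card_filter, ← sum_add_distrib, ← prod_pow_eq_pow_sum]
  rw [minorTerm, norm_mul]
  refine (mul_le_of_le_one_left (norm_nonneg _)
    (IsUltrametricDist.norm_intCast_le_one K _)).trans ?_
  simp only [norm_prod]
  gcongr with i _ d _
  exact hfactor i d

theorem norm_minorTerm_le_of_not_isCritical (hpK : ‖(p : K)‖ < 1)
    (hϖ : ϖ ^ (p - 1) = -(p : K)) (ha : ∀ d, ‖a d‖ ≤ 1) (hc : Injective c)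
    (hx : IsClosedSystem D p (fun i => c i) x.1 x.2) (hcrit : ¬IsCritical D p x.2) :
    ‖minorTerm p ϖ D a x‖ ≤ ‖ϖ‖ ^ (minorOrder D p (Fintype.card ι) + 1) := by
  have hp := (Fact.out : p.Prime).one_lt
  refine (norm_minorTerm_le hpK hϖ ha x).trans
    (pow_le_pow_of_le_one (norm_nonneg _) (norm_uniformizer_lt_one hp hpK hϖ).le ?_)
  have horder := hx.minorOrder_le hp hc
  rw [sum_add_distrib]
  by_cases hdigits : ∀ i d, x.2 i d < p
  · have hne := mt (hx.isCritical_of_sum_eq_minorOrder hp hc hdigits) hcrit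
    omega
  · push Not at hdigits
    obtain ⟨i, d, hid⟩ := hdigits
    have hcard : 0 < #{d | p ≤ x.2 i d} := card_pos.2 ⟨d, mem_filter_univ d |>.2 hid⟩
    have hsum := single_le_sum (f := fun i => #{d | p ≤ x.2 i d})
      (fun _ _ => Nat.zero_le _) (mem_univ i)
    omega

theorem norm_det_submatrix_sub_sum_isCritical_le (hpK : ‖(p : K)‖ < 1)
    (hϖ : ϖ ^ (p - 1) = -(p : K)) (hpos : ∀ d ∈ D, 0 < d) (ha : ∀ d, ‖a d‖ ≤ 1)
    (hc : Injective c) (hB : ∀ i, p * c i < B)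
    [DecidablePred fun x : Equiv.Perm ι × (ι → D → ℕ) => IsCritical D p x.2] :
    ‖((A₁ p ϖ D a).submatrix c c).det -
        (∑ x ∈ closedSystems D p B c with IsCritical D p x.2,
          (Equiv.Perm.sign x.1 : K) * (∏ i, ∏ d : D, (a d ^ x.2 i d / ((x.2 i d).factorial : K)))) *
          ϖ ^ minorOrder D p (Fintype.card ι)‖ ≤
      ‖ϖ‖ ^ (minorOrder D p (Fintype.card ι) + 1) := by
  rw [det_submatrix_A₁ ϖ hpos a hB, sum_mul,
    ← sum_congr rfl fun x hx => minorTerm_of_isCritical hϖ a (mem_filter.1 hx).2,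
    ← sum_filter_add_sum_filter_not _ fun x => IsCritical D p x.2, add_sub_cancel_left]
  refine IsUltrametricDist.norm_sum_le_of_forall_le_of_nonneg (by positivity) fun x hx => ?_
  obtain ⟨hmem, hcrit⟩ := mem_filter.1 hx
  exact norm_minorTerm_le_of_not_isCritical hpK hϖ ha hc (mem_closedSystems.1 hmem).2 hcrit

theorem norm_det_submatrix_sub_le_of_range_eq (hpK : ‖(p : K)‖ < 1)
    (hϖ : ϖ ^ (p - 1) = -(p : K)) (hpos : ∀ d ∈ D, 0 < d) (ha : ∀ d, ‖a d‖ ≤ 1)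
    (hc : Injective c) (hrange : Set.range (fun i => (c i : ℕ)) = sigmaSet D p) :
    ‖((A₁ p ϖ D a).submatrix c c).det -
        MvPolynomial.aeval a (hassePoly D p) * ϖ ^ minorOrder D p (Fintype.card ι)‖ ≤
      ‖ϖ‖ ^ (minorOrder D p (Fintype.card ι) + 1) := by
  classical
  obtain ⟨M, hM⟩ := Finite.exists_le fun i => p * (c i : ℕ)
  rw [← sum_isCritical_eq_aeval_hassePoly (Nat.le_add_left p M) hc hrange a]
  exact norm_det_submatrix_sub_sum_isCritical_le hpK hϖ hpos ha hc fun i =>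
    (hM i).trans_lt (Nat.lt_add_of_pos_right (Fact.out : p.Prime).pos)

theorem norm_det_submatrix_le_of_not_range_subset (hpK : ‖(p : K)‖ < 1)
    (hϖ : ϖ ^ (p - 1) = -(p : K)) (hpos : ∀ d ∈ D, 0 < d) (ha : ∀ d, ‖a d‖ ≤ 1)
    (hc : Injective c) (hrange : ¬Set.range (fun i => (c i : ℕ)) ⊆ sigmaSet D p) :
    ‖((A₁ p ϖ D a).submatrix c c).det‖ ≤ ‖ϖ‖ ^ (minorOrder D p (Fintype.card ι) + 1) := by
  classical
  obtain ⟨M, hM⟩ := Finite.exists_le fun i => p * (c i : ℕ)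
  have hle := norm_det_submatrix_sub_sum_isCritical_le hpK hϖ hpos ha hc fun i =>
    Nat.lt_succ_of_le (hM i)
  rwa [filter_eq_empty_iff.2 fun x hx hcrit => hrange <|
    (mem_closedSystems.1 hx).2.range_subset_sigmaSet (Fact.out : p.Prime).one_lt
      (PNat.coe_injective.comp hc) (fun i => (c i).pos) hcrit, sum_empty, zero_mul,
    sub_zero] at hle

end Norms

end Minors

/-! ### The leading coefficient -/

section LeadingCoefficient

open Finset Filter Function

variable {p : ℕ} {D : Finset ℕ}

/-- The set `Σ_{D,p}` as a finite set of indices of `A_1`. -/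
noncomputable def sigmaFinset (D : Finset ℕ) (p : ℕ) : Finset ℕ+ :=
  ((sigmaSet_finite D p).preimage PNat.coe_injective.injOn).toFinset

theorem mem_sigmaFinset {i : ℕ+} : i ∈ sigmaFinset D p ↔ (i : ℕ) ∈ sigmaSet D p := by
  simp [sigmaFinset]

theorem range_sigmaFinset (hp : 1 < p) :
    Set.range (fun i : sigmaFinset D p => ((i : ℕ+) : ℕ)) = sigmaSet D p := by
  refine subset_antisymm (Set.range_subset_iff.2 fun i => mem_sigmaFinset.1 i.2) fun v hv => ?_
  obtain ⟨x, hx, hvx⟩ := Set.mem_iUnion₂.1 hv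
  obtain ⟨k, -, rfl⟩ := mem_image.1 (mem_coe.1 hvx)
  exact ⟨⟨⟨_, phiSeq_pos hp hx.1 k⟩, mem_sigmaFinset.2 hv⟩, rfl⟩

theorem card_sigmaFinset (hp : 1 < p) : #(sigmaFinset D p) = sigmaCard D p := by
  have hinj : Injective fun i : sigmaFinset D p => ((i : ℕ+) : ℕ) :=
    PNat.coe_injective.comp Subtype.val_injective
  rw [sigmaCard, ← range_sigmaFinset hp, ← Set.image_univ, Set.ncard_image_of_injective _ hinj,
    Set.ncard_univ, Nat.card_eq_fintype_card, Fintype.card_coe]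

variable {K : Type*} [NormedField K] [CharZero K] [IsUltrametricDist K] [Fact p.Prime] {ϖ : K}
  {a : D → K}

theorem norm_det_submatrix_le_of_ne_sigmaFinset (hpK : ‖(p : K)‖ < 1)
    (hϖ : ϖ ^ (p - 1) = -(p : K)) (hpos : ∀ d ∈ D, 0 < d) (ha : ∀ d, ‖a d‖ ≤ 1)
    {S : Finset ℕ+} (hcard : #S = sigmaCard D p) (hne : S ≠ sigmaFinset D p) :
    ‖((A₁ p ϖ D a).submatrix (Subtype.val : S → ℕ+) Subtype.val).det‖ ≤
      ‖ϖ‖ ^ (minorOrder D p (sigmaCard D p) + 1) := by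
  rw [← hcard, ← Fintype.card_coe]
  refine norm_det_submatrix_le_of_not_range_subset hpK hϖ hpos ha Subtype.val_injective
    fun hrange => hne (eq_of_subset_of_card_le (fun i hi => ?_) ?_)
  · exact mem_sigmaFinset.2 (hrange ⟨⟨i, hi⟩, rfl⟩)
  · rw [card_sigmaFinset (Fact.out : p.Prime).one_lt, hcard]

theorem norm_coeff_charpolyRev_sub_le (hpK : ‖(p : K)‖ < 1) (hϖ : ϖ ^ (p - 1) = -(p : K))
    (hpos : ∀ d ∈ D, 0 < d) (ha : ∀ d, ‖a d‖ ≤ 1) {S : Finset ℕ+} (hS : sigmaFinset D p ⊆ S) :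
    ‖((A₁ p ϖ D a).submatrix (Subtype.val : S → ℕ+) Subtype.val).charpolyRev.coeff
        (sigmaCard D p) -
      (-1) ^ sigmaCard D p * MvPolynomial.aeval a (hassePoly D p) *
        ϖ ^ minorOrder D p (sigmaCard D p)‖ ≤
      ‖ϖ‖ ^ (minorOrder D p (sigmaCard D p) + 1) := by
  have hp := (Fact.out : p.Prime).one_lt
  have hsigma := norm_det_submatrix_sub_le_of_range_eq hpK hϖ hpos ha Subtype.val_injective
    (range_sigmaFinset hp)
  rw [Fintype.card_coe, card_sigmaFinset hp] at hsigma
  rw [coeff_charpolyRev_submatrix, mul_assoc, ← mul_sub, norm_mul, norm_pow, norm_neg, norm_one,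
    one_pow, one_mul,
    ← add_sum_erase _ _ (mem_powersetCard.2 ⟨hS, card_sigmaFinset hp⟩), add_sub_right_comm]
  refine (IsUltrametricDist.norm_add_le_max _ _).trans (max_le hsigma ?_)
  refine IsUltrametricDist.norm_sum_le_of_forall_le_of_nonneg (by positivity) fun s hs => ?_
  obtain ⟨hne, hmem⟩ := mem_erase.1 hs
  exact norm_det_submatrix_le_of_ne_sigmaFinset hpK hϖ hpos ha (mem_powersetCard.1 hmem).2 hne

theorem norm_coeff_fredholmDet_sub_le (hpK : ‖(p : K)‖ < 1) (hϖ : ϖ ^ (p - 1) = -(p : K))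
    (hpos : ∀ d ∈ D, 0 < d) (ha : ∀ d, ‖a d‖ ≤ 1) {P : PowerSeries K}
    (hP : IsFredholmDet (A₁ p ϖ D a) P) :
    ‖PowerSeries.coeff (sigmaCard D p) P -
      (-1) ^ sigmaCard D p * MvPolynomial.aeval a (hassePoly D p) *
        ϖ ^ minorOrder D p (sigmaCard D p)‖ ≤
      ‖ϖ‖ ^ (minorOrder D p (sigmaCard D p) + 1) := by
  refine le_of_tendsto ((hP (sigmaCard D p)).sub_const _).norm ?_
  filter_upwards [eventually_ge_atTop (sigmaFinset D p)] with S hS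
  exact norm_coeff_charpolyRev_sub_le hpK hϖ hpos ha hS

end LeadingCoefficient

theorem norm_natCast_padicComplex_lt_one (p : ℕ) [Fact p.Prime] : ‖(p : ℂ_[p])‖ < 1 := by
  have h := PadicComplex.norm_extends' p (p : ℚ_[p])
  rw [map_natCast, PadicComplex.coe_natCast] at h
  rw [h]
  exact Padic.norm_p_lt_one

theorem norm_liftCoeff_le_one {p : ℕ} [Fact p.Prime] {k K : Type*} [Field k] [Finite k]
    [NormedField K] (j : WittVector p k →+* K) (D : Finset ℕ) (f : Polynomial k) (d : D) :
    ‖liftCoeff p j D f d‖ ≤ 1 := by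
  have := Fintype.ofFinite k
  have hpow : liftCoeff p j D f d ^ Fintype.card k = liftCoeff p j D f d := by
    rw [liftCoeff, ← map_pow, ← map_pow, FiniteField.pow_card]
  have hnorm := congrArg norm hpow
  rw [norm_pow] at hnorm
  by_contra! hlt
  exact (lt_self_pow₀ hlt Fintype.one_lt_card).ne' hnorm

theorem uniformizer_ne_zero {K : Type*} [Field K] [CharZero K] {p : ℕ} [Fact p.Prime] {ϖ : K}
    (hϖ : ϖ ^ (p - 1) = -(p : K)) : ϖ ≠ 0 := by
  have hp := (Fact.out : p.Prime)
  refine ne_zero_pow (Nat.sub_ne_zero_of_lt hp.one_lt) ?_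
  rw [hϖ]
  exact neg_ne_zero.2 (Nat.cast_ne_zero.2 hp.ne_zero)

theorem congrMod_of_norm_sub_le {K : Type*} [NormedField K] {ϖ x y : K} (hϖ : ϖ ≠ 0) {r : ℕ}
    (h : ‖x - y‖ ≤ ‖ϖ‖ ^ r) : CongrMod ϖ r x y := by
  refine ⟨(x - y) / ϖ ^ r, ?_, (mul_div_cancel₀ _ (pow_ne_zero _ hϖ)).symm⟩
  rw [norm_div, norm_pow]
  exact div_le_one_of_le₀ h (by positivity)

end DworkHasse

theorem proposition3p9_general {K : Type*} [NormedField K] [CharZero K] [IsUltrametricDist K]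
    [CompleteSpace K] (p : ℕ) [Fact p.Prime] (hpK : ‖(p : K)‖ < 1) (D : Finset ℕ)
    (hpos : ∀ d ∈ D, 0 < d) (a : D → K) (ha : ∀ d, ‖a d‖ ≤ 1)
    (ϖ : K) (hϖ : ϖ ^ (p - 1) = -(p : K)) :
    ∃ P : PowerSeries K,
      DworkHasse.IsFredholmDet (DworkHasse.A₁ p ϖ D a) P ∧
      DworkHasse.CongrMod ϖ
        (⌊(DworkHasse.sigmaCard D p : ℝ) * ((p : ℝ) - 1) * DworkHasse.density D p⌋₊ + 1)
        (PowerSeries.coeff (DworkHasse.sigmaCard D p) P)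
        ((-1) ^ DworkHasse.sigmaCard D p *
          MvPolynomial.aeval a (DworkHasse.hassePoly D p) *
          ϖ ^ ⌊(DworkHasse.sigmaCard D p : ℝ) * ((p : ℝ) - 1) * DworkHasse.density D p⌋₊) := by
  obtain ⟨P, hP⟩ := DworkHasse.exists_isFredholmDet_A₁ hpK hϖ hpos ha
  exact ⟨P, hP, DworkHasse.congrMod_of_norm_sub_le (DworkHasse.uniformizer_ne_zero hϖ)
    (DworkHasse.norm_coeff_fredholmDet_sub_le hpK hϖ hpos ha hP)⟩

/-- For every `f` over a finite field `k` of characteristic `p` with exponents in `D`, the Fredholm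
determinant `P = det(I - T A_1)` exists, and its coefficient of index `N = N_{D,p}` is congruent to
`(-1) ^ N H(A) π ^ e` modulo `π ^ (e + 1)`, with `e = N (p - 1) δ_{D,p}`. If `N (p - 1) δ_{D,p}` is
not an integer, then `e` is its integral part; in this case no partition of `Σ_{D,p}` into supports
exists and `H = 0`. -/
theorem proposition3p9 (p : ℕ) [Fact p.Prime] (D : Finset ℕ) (hD : D.Nonempty)
    (hpos : ∀ d ∈ D, 0 < d)
    {k : Type*} [Field k] [Finite k] [CharP k p] (f : Polynomial k) (hf : f.support ⊆ D)
    (j : WittVector p k →+* ℂ_[p])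
    (ϖ : ℂ_[p]) (hϖ : ϖ ^ (p - 1) = -(p : ℂ_[p])) :
    ∃ P : PowerSeries ℂ_[p],
      DworkHasse.IsFredholmDet (DworkHasse.A₁ p ϖ D (DworkHasse.liftCoeff p j D f)) P ∧
      DworkHasse.CongrMod ϖ
        (⌊(DworkHasse.sigmaCard D p : ℝ) * ((p : ℝ) - 1) * DworkHasse.density D p⌋₊ + 1)
        (PowerSeries.coeff (DworkHasse.sigmaCard D p) P)
        ((-1) ^ DworkHasse.sigmaCard D p *
          MvPolynomial.aeval (DworkHasse.liftCoeff p j D f) (DworkHasse.hassePoly D p) *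
          ϖ ^ ⌊(DworkHasse.sigmaCard D p : ℝ) * ((p : ℝ) - 1) * DworkHasse.density D p⌋₊) :=
  proposition3p9_general p (DworkHasse.norm_natCast_padicComplex_lt_one p) D hpos _
    (DworkHasse.norm_liftCoeff_le_one j D f) ϖ hϖ
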